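/- **Setting.** Let $2\le \ell\le\infty$ and $a>0$. For $i=1,\dots,n$ we observe $X_i\in\mathbb R^p$ and $Y_i = X_i^\top\beta^* + \theta_i+\xi_i$, where $\beta^*\in\mathbb R^p$ is fixed. The vectors $X_i$ are i.i.d., centered, isotropic ($\mathbf E X_1X_1^\top = \mathrm I_p$) and $1$-sub-Gaussian ($\mathbf E e^{\langle u,X_1\rangle}\le e^{\|u\|^2/2}$ for all $u\in\mathbb R^p$). The noise variables $\xi_i$ are independent of the $X_i$ and i.i.d., centered, with unit variance and with $\mathbf E|\xi_1|^\ell\le a^\ell$ (if $\ell=\infty$: with $\mathbf P(|\xi_1|\ge t)\le 2e^{-t^2/(2a^2)}$ for all $t\ge 0$). The vector $\theta$ is chosen by an adversary who knows everything (it may be any function of the outcome), and has at most $o$ nonzero entries. For $\tau>0$ the Welsch objective is $$f_\tau(\beta)=\frac1n\sum_{i=1}^n\frac1\tau\Bigl(1-\exp\bigl(-\tfrac{\tau}{2}(Y_i-X_i^\top\beta)^2\bigr)\Bigr).$$ The two-stage algorithm first computes a least absolute deviation (LAD) estimate $\beta_{\mathrm{LAD}}\in\arg\min_\beta\sum_i|Y_i-X_i^\top\beta|$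 (an approximate minimizer, with an excess of at most $\varepsilon n$ in the sum for some $\varepsilon\in[0,1]$, is also allowed), and then minimizes $f_\tau$ by a descent method started at $\beta_{\mathrm{LAD}}$: either any method along which $f_\tau$ does not increase and $\nabla f_\tau$ tends to $0$, or gradient descent with a constant step size $\eta\in(0,\eta_0]$. **Proposition.** There are constants $C_0,\eta_0>0$, depending only on $a$, such that the following holds. Let $C>0$ and $2\le\ell_{\max}\le\infty$, with $C\le C_0$ or $\ell_{\max}<\infty$. Then there is a constant $C_1>0$, depending only on $a$, $C$ and $\ell_{\max}$, such that for all $\ell\in[2,\ell_{\max}]$, all $n$, $p$, $o$ and $\delta\in(0,1)$ with $n\ge C_1(o+\log(1/\delta)+p)$, every model as above, and $$\tau = C\Bigl(\frac{o+\log(1/\delta)}{n}\Bigr)^{2/\ell},$$ the following holds with probability at least $1-\delta$. LAD estimates exist; $f_\tau$ has a unique global minimizer $\hat\beta$ on $\mathbb R^p$; the two-stage algorithm converges to $\hat\beta$ from every first-stage output; and $$\|\hat\beta-\beta^*\|\le C_1\left(\Bigl(\frac on\Bigr)^{1-1/\ell}\sqrt{\log\frac{en}{2o}}+\sqrt{\frac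 pn}+\sqrt{\frac{\log(1/\delta)}{n}\log\frac{en}{2\log(1/\delta)}}\right),$$ where the first term is $0$ if $o=0$ (and $1/\ell=2/\ell=0$ if $\ell=\infty$). -/

import Mathlib

open MeasureTheory ProbabilityTheory Filter Topology
open scoped ENNReal

noncomputable section

/-- The Welsch loss `l_τ(x) = (1 - exp (-τ x² / 2)) / τ`. -/
def welschLoss (τ x : ℝ) : ℝ :=
  1 / τ * (1 - Real.exp (-τ * x ^ 2 / 2))

/-- The empirical Welsch objective of the sample `(x i, y i)`, `i < n`. -/
def welschObjective {n p : ℕ} (τ : ℝ) (x : Fin n → EuclideanSpace ℝ (Fin p)) (y : Fin n → ℝ)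
    (β : EuclideanSpace ℝ (Fin p)) : ℝ :=
  1 / (n : ℝ) * ∑ i, welschLoss τ (y i - inner ℝ (x i) β)

/-- The least absolute deviation (LAD) objective. -/
def ladObjective {n p : ℕ} (x : Fin n → EuclideanSpace ℝ (Fin p)) (y : Fin n → ℝ)
    (β : EuclideanSpace ℝ (Fin p)) : ℝ :=
  ∑ i, |y i - inner ℝ (x i) β|

/-- `β` minimizes the LAD objective, up to an error `ε` per observation. For `ε = 0` this says
that `β` is a LAD estimator; for `ε > 0` it also covers a LAD solver that is stopped early. -/
def IsLADEstimate {n p : ℕ} (x : Fin n → EuclideanSpace ℝ (Fin p)) (y : Fin n → ℝ) (ε : ℝ)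
    (β : EuclideanSpace ℝ (Fin p)) : Prop :=
  ∀ β', ladObjective x y β ≤ ladObjective x y β' + ε * n

/-- `b` is the sequence of iterates of a descent method for `f`, started at `β₀`: the objective
never increases and the gradient tends to zero. -/
structure IsDescentRun {p : ℕ} (f : EuclideanSpace ℝ (Fin p) → ℝ)
    (β₀ : EuclideanSpace ℝ (Fin p)) (b : ℕ → EuclideanSpace ℝ (Fin p)) : Prop where
  start : b 0 = β₀
  descent : ∀ k, f (b (k + 1)) ≤ f (b k)
  stationary : Tendsto (fun k => gradient f (b k)) atTop (𝓝 0)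

/-- The iterates of gradient descent for `f` with constant step size `η`, started at `β₀`. -/
def gradientDescent {p : ℕ} (f : EuclideanSpace ℝ (Fin p) → ℝ) (η : ℝ)
    (β₀ : EuclideanSpace ℝ (Fin p)) : ℕ → EuclideanSpace ℝ (Fin p)
  | 0 => β₀
  | k + 1 => gradientDescent f η β₀ k - η • gradient f (gradientDescent f η β₀ k)

/-- The class of noise laws: `E |ξ|^ℓ ≤ a^ℓ` if `ℓ < ∞`, and the sub-Gaussian tail bound
`P(|ξ| ≥ t) ≤ 2 exp (-t² / (2 a²))` for all `t ≥ 0` if `ℓ = ∞`. -/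
def IsInNoiseClass (ℓ : ℝ≥0∞) (a : ℝ) (P : Measure ℝ) : Prop :=
  (ℓ ≠ ∞ → ∫⁻ t, ENNReal.ofReal (|t| ^ ℓ.toReal) ∂P ≤ ENNReal.ofReal (a ^ ℓ.toReal)) ∧
  (ℓ = ∞ → ∀ t : ℝ, 0 ≤ t → P.real {s | t ≤ |s|} ≤ 2 * Real.exp (-t ^ 2 / (2 * a ^ 2)))

variable {Ω : Type*} [MeasurableSpace Ω]

/-- `X 0, …, X (n-1)` are i.i.d. random vectors that are centered, isotropic and
`1`-sub-Gaussian. -/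
structure IsSubGaussianDesign (μ : Measure Ω) {n p : ℕ}
    (X : Fin n → Ω → EuclideanSpace ℝ (Fin p)) : Prop where
  measurable : ∀ i, Measurable (X i)
  indep : iIndepFun X μ
  identDistrib : ∀ i j, IdentDistrib (X i) (X j) μ μ
  centered : ∀ i, ∫ ω, X i ω ∂μ = 0
  isotropic : ∀ i j k, ∫ ω, X i ω j * X i ω k ∂μ = (1 : Matrix (Fin p) (Fin p) ℝ) j k
  integrable_exp : ∀ i u, Integrable (fun ω => Real.exp (inner ℝ u (X i ω))) μ
  subGaussian : ∀ i u, ∫ ω, Real.exp (inner ℝ u (X i ω)) ∂μ ≤ Real.exp (‖u‖ ^ 2 / 2)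

/-- `ξ 0, …, ξ (n-1)` are i.i.d. centered random variables of unit variance whose law is in the
noise class with parameters `ℓ` and `a`. -/
structure IsNoise (μ : Measure Ω) {n : ℕ} (ℓ : ℝ≥0∞) (a : ℝ) (ξ : Fin n → Ω → ℝ) : Prop where
  measurable : ∀ i, Measurable (ξ i)
  indep : iIndepFun ξ μ
  identDistrib : ∀ i j, IdentDistrib (ξ i) (ξ j) μ μ
  memLp : ∀ i, MemLp (ξ i) 2 μ
  centered : ∀ i, ∫ ω, ξ i ω ∂μ = 0
  unit_variance : ∀ i, variance (ξ i) μ = 1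
  moment : ∀ i, IsInNoiseClass ℓ a (μ.map (ξ i))

end

/-! The proof separates a deterministic analysis of "regular" samples from the probability that a
sample is regular. Regularity (`IsRegularSample`) asks that the design be nearly isotropic from both
sides, that no small set of indices carry much of the energy of the design in any direction, and
that few residuals at `β*` be large.

On a regular sample the nonconvexity of the Welsch loss is harmless. If `τ ‖β - β*‖²` is at most a
small constant, nearly all residuals lie where the loss is strongly convex. The few others cost
little, since the negative curvature is bounded and small index sets carry little energy. So the
gradient is strongly monotone there (`strongly_monotone`). Outside this region a fixed proportion of
residuals is of order at least `τ^{-1/2}`, so the objective exceeds its value at every point within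
constant distance of `β*` (`welschObjective_lt`). A LAD estimate is such a point
(`norm_sub_le_of_isLADEstimate`), hence a descent run started at it never leaves the region. There
`‖β - βhat‖ ≤ 8 ‖∇f(β)‖`. This single inequality gives uniqueness, convergence, and, at `β = β*`,
the error bound (`exists_minimizer`).

It remains to bound the gradient at `β*`, with `ψ` the derivative of the loss. The noise part `∑
ψ(ξ_i) X_i` has no bias, because the centered `X_i` are independent of `ξ`. Given `ξ`, it is
sub-Gaussian with variance proxy `∑ ψ(ξ_i)²`, which is `O(n)`. The outliers change at most `o` of
the weights, each by at most `2 / √τ`. Their effect is bounded by the operator norm of the design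
restricted to their indices, of order `√(o log(en/2o) + p + log(1/δ))`, times `√(o/τ)`. The choice
of `τ` gives `o/(nτ) ≤ (o/n)^{1-2/ℓ}/C`, whence the rate.

Since the adversary sees the data, the design bound must hold for all index sets at once. It follows
without a union bound over sets: in a fixed direction, `∑_{i∈S} z_i² ≤ |S| T + ∑_i (z_i² - T)₊`, and
the last sum does not depend on `S`. Chernoff bounds and nets of the ball do the rest. -/

/-! ### The Welsch loss on the real line -/

/-- The derivative `r e^{-τ r² / 2}` of the Welsch loss. -/
noncomputable def welschInfluence (τ r : ℝ) : ℝ := r * Real.exp (-τ * r ^ 2 / 2)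

lemma hasDerivAt_welschLoss {τ : ℝ} (hτ : τ ≠ 0) (r : ℝ) :
    HasDerivAt (welschLoss τ) (welschInfluence τ r) r := by
  have h1 : HasDerivAt (fun x : ℝ => -τ * x ^ 2 / 2) (-τ * r) r := by
    have := ((hasDerivAt_pow 2 r).const_mul (-τ)).div_const 2
    refine this.congr_deriv ?_
    push_cast
    ring
  have h2 := ((h1.exp).const_sub 1).const_mul (1 / τ)
  refine h2.congr_deriv ?_
  unfold welschInfluence
  field_simp

lemma hasDerivAt_welschInfluence (τ r : ℝ) :
    HasDerivAt (welschInfluence τ) ((1 - τ * r ^ 2) * Real.exp (-τ * r ^ 2 / 2)) r := by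
  have h1 : HasDerivAt (fun x : ℝ => -τ * x ^ 2 / 2) (-τ * r) r := by
    have := ((hasDerivAt_pow 2 r).const_mul (-τ)).div_const 2
    refine this.congr_deriv ?_
    push_cast
    ring
  refine ((hasDerivAt_id r).mul h1.exp).congr_deriv ?_
  simp only [id]
  ring

/-- With `z = τ r²` the derivative is `(1 - z) e^{-z/2}`, and `|1 - z| ≤ 1 + z/2 + z²/8 ≤ e^{z/2}`.
The constant does not depend on `τ`, so neither will the admissible step sizes. -/
lemma abs_welschInfluence_sub_le {τ : ℝ} (hτ : 0 ≤ τ) (s t : ℝ) :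
    |welschInfluence τ s - welschInfluence τ t| ≤ |s - t| := by
  have key : ∀ r : ℝ, ‖(1 - τ * r ^ 2) * Real.exp (-τ * r ^ 2 / 2)‖ ≤ 1 := by
    intro r
    have hz : 0 ≤ τ * r ^ 2 := by positivity
    set z := τ * r ^ 2 with hzdef
    have he : Real.exp (-τ * r ^ 2 / 2) = (Real.exp (z / 2))⁻¹ := by
      rw [← Real.exp_neg, hzdef]; congr 1; ring
    rw [he, norm_mul, Real.norm_eq_abs, Real.norm_eq_abs, abs_of_pos (a := (Real.exp (z / 2))⁻¹)
      (by positivity), mul_inv_le_iff₀ (Real.exp_pos _), one_mul]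
    have := Real.quadratic_le_exp_of_nonneg (x := z / 2) (by positivity)
    rw [abs_le]
    constructor <;> nlinarith [sq_nonneg (z - 2)]
  have := Convex.norm_image_sub_le_of_norm_hasDerivWithin_le (f := welschInfluence τ)
    (s := Set.univ) (C := 1) (fun r _ => (hasDerivAt_welschInfluence τ r).hasDerivWithinAt)
    (fun r _ => key r) convex_univ (Set.mem_univ t) (Set.mem_univ s)
  simpa using this

/-- In this range the derivative is at least `(3/4)(7/8) > 1/2`: here the loss is strongly convex.
-/
lemma half_mul_sq_le_welschInfluence_sub_mul {τ s t : ℝ} (hτ : 0 ≤ τ) (hs : τ * s ^ 2 ≤ 1 / 4)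
    (ht : τ * t ^ 2 ≤ 1 / 4) :
    1 / 2 * (s - t) ^ 2 ≤ (welschInfluence τ s - welschInfluence τ t) * (s - t) := by
  set m := max |s| |t| with hm
  have hm2 : τ * m ^ 2 ≤ 1 / 4 := by
    rcases max_choice |s| |t| with h | h <;> rw [hm, h, sq_abs] <;> assumption
  have mono : MonotoneOn (fun r => welschInfluence τ r - r / 2) (Set.Icc (-m) m) := by
    have hd : ∀ r, HasDerivAt (fun r => welschInfluence τ r - r / 2)
        ((1 - τ * r ^ 2) * Real.exp (-τ * r ^ 2 / 2) - 1 / 2) r := fun r =>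
      (hasDerivAt_welschInfluence τ r).sub ((hasDerivAt_id r).div_const 2)
    refine monotoneOn_of_deriv_nonneg (convex_Icc _ _)
      (fun r _ => (hd r).continuousAt.continuousWithinAt)
      (fun r _ => (hd r).differentiableAt.differentiableWithinAt) ?_
    intro r hr
    rw [interior_Icc] at hr
    rw [(hd r).deriv]
    have hr2 : r ^ 2 ≤ m ^ 2 := by
      apply sq_le_sq' <;> linarith [hr.1, hr.2]
    have h1 : τ * r ^ 2 ≤ 1 / 4 := (mul_le_mul_of_nonneg_left hr2 hτ).trans hm2
    have h0 : 0 ≤ τ * r ^ 2 := by positivity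
    have h2 := Real.add_one_le_exp (-τ * r ^ 2 / 2)
    nlinarith
  have hsm : s ∈ Set.Icc (-m) m := abs_le.1 (le_max_left _ _)
  have htm : t ∈ Set.Icc (-m) m := abs_le.1 (le_max_right _ _)
  rcases le_total s t with h | h
  · have := mono hsm htm h
    simp only at this
    nlinarith
  · have := mono htm hsm h
    simp only at this
    nlinarith

lemma welschLoss_nonneg {τ : ℝ} (hτ : 0 < τ) (r : ℝ) : 0 ≤ welschLoss τ r := by
  unfold welschLoss
  have : Real.exp (-τ * r ^ 2 / 2) ≤ 1 := Real.exp_le_one_iff.2 (by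
    have : 0 ≤ τ * r ^ 2 := by positivity
    linarith)
  have h2 : 0 ≤ 1 - Real.exp (-τ * r ^ 2 / 2) := by linarith
  positivity

lemma sq_welschInfluence_le {τ : ℝ} (hτ : 0 < τ) (r : ℝ) :
    welschInfluence τ r ^ 2 ≤ 1 / τ * min (τ * r ^ 2) 1 := by
  have hz : 0 ≤ τ * r ^ 2 := by positivity
  have he : welschInfluence τ r ^ 2 = r ^ 2 * (Real.exp (τ * r ^ 2))⁻¹ := by
    unfold welschInfluence
    rw [mul_pow, ← Real.exp_nat_mul, ← Real.exp_neg]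
    congr 2; push_cast; ring
  have h1 := Real.add_one_le_exp (τ * r ^ 2)
  rw [he, ← div_eq_mul_inv, div_le_iff₀ (Real.exp_pos _)]
  rcases min_choice (τ * r ^ 2) 1 with h | h <;> rw [h]
  · have : 1 / τ * (τ * r ^ 2) = r ^ 2 := by field_simp
    rw [this]
    nlinarith [sq_nonneg r]
  · calc r ^ 2 = 1 / τ * (τ * r ^ 2) := by field_simp
      _ ≤ 1 / τ * 1 * Real.exp (τ * r ^ 2) := by
        rw [mul_one]
        exact mul_le_mul_of_nonneg_left (by linarith) (by positivity)

/-! ### Deterministic analysis of the two-stage algorithm on a regular sample -/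

section Deterministic

variable {n p : ℕ}

lemma hasGradientAt_welschObjective {τ : ℝ} (hτ : τ ≠ 0) (x : Fin n → EuclideanSpace ℝ (Fin p))
    (y : Fin n → ℝ) (β : EuclideanSpace ℝ (Fin p)) :
    HasGradientAt (welschObjective τ x y)
      (-(1 / (n : ℝ)) • ∑ i, welschInfluence τ (y i - inner ℝ (x i) β) • x i) β := by
  rw [hasGradientAt_iff_hasFDerivAt]
  have h1 : ∀ i, HasFDerivAt (fun β => welschLoss τ (y i - inner ℝ (x i) β))
      (welschInfluence τ (y i - inner ℝ (x i) β) • (-(innerSL ℝ (x i)))) β := by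
    intro i
    have := ((innerSL ℝ (x i)).hasFDerivAt (x := β)).const_sub (y i)
    exact (hasDerivAt_welschLoss hτ _).comp_hasFDerivAt β this
  have h2 := (HasFDerivAt.fun_sum (u := Finset.univ) fun i _ => h1 i).const_mul (1 / (n : ℝ))
  refine h2.congr_fderiv ?_
  ext v
  simp [Finset.mul_sum, InnerProductSpace.toDual]

lemma gradient_welschObjective {τ : ℝ} (hτ : τ ≠ 0) (x : Fin n → EuclideanSpace ℝ (Fin p))
    (y : Fin n → ℝ) (β : EuclideanSpace ℝ (Fin p)) :
    gradient (welschObjective τ x y) β =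
      -(1 / (n : ℝ)) • ∑ i, welschInfluence τ (y i - inner ℝ (x i) β) • x i :=
  (hasGradientAt_welschObjective hτ x y β).gradient

lemma continuous_welschObjective {τ : ℝ} (hτ : τ ≠ 0) (x : Fin n → EuclideanSpace ℝ (Fin p))
    (y : Fin n → ℝ) : Continuous (welschObjective τ x y) :=
  continuous_iff_continuousAt.2 fun β => (hasGradientAt_welschObjective hτ x y β).continuousAt

lemma welschObjective_nonneg {τ : ℝ} (hτ : 0 < τ) (x : Fin n → EuclideanSpace ℝ (Fin p))
    (y : Fin n → ℝ) (β : EuclideanSpace ℝ (Fin p)) : 0 ≤ welschObjective τ x y β :=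
  mul_nonneg (by positivity) (Finset.sum_nonneg fun i _ => welschLoss_nonneg hτ _)

/-- The inner product of a difference of gradients with a vector. -/
lemma inner_gradient_sub {τ : ℝ} (hτ : τ ≠ 0) (x : Fin n → EuclideanSpace ℝ (Fin p))
    (y : Fin n → ℝ) (β γ v : EuclideanSpace ℝ (Fin p)) :
    inner ℝ (gradient (welschObjective τ x y) β - gradient (welschObjective τ x y) γ) v =
      1 / (n : ℝ) * ∑ i, (welschInfluence τ (y i - inner ℝ (x i) γ) -
        welschInfluence τ (y i - inner ℝ (x i) β)) * inner ℝ (x i) v := by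
  rw [gradient_welschObjective hτ, gradient_welschObjective hτ, ← smul_sub,
    ← Finset.sum_sub_distrib, inner_smul_left, sum_inner]
  simp only [← sub_smul, inner_smul_left, conj_trivial]
  rw [neg_mul, ← mul_neg, ← Finset.sum_neg_distrib]
  congr 1
  exact Finset.sum_congr rfl fun i _ => by ring

/-- A deterministic regularity condition on the design `x` and the residuals `e` at the true
parameter, under which the two-stage algorithm works. -/
structure IsRegularSample (x : Fin n → EuclideanSpace ℝ (Fin p)) (e : Fin n → ℝ) : Prop where
  pos : 0 < n
  lower : ∀ u, (n : ℝ) / 2 * ‖u‖ ^ 2 ≤ ∑ i, inner ℝ (x i) u ^ 2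
  upper : ∀ u, ∑ i, inner ℝ (x i) u ^ 2 ≤ 81 * (n : ℝ) * ‖u‖ ^ 2
  small : ∀ S : Finset (Fin n), (S.card : ℝ) ≤ n / 12000 → ∀ u,
    ∑ i ∈ S, inner ℝ (x i) u ^ 2 ≤ (n : ℝ) / 12 * ‖u‖ ^ 2
  noise : ∑ i, min (1 / 10 ^ 18 * e i ^ 2) 1 ≤ (n : ℝ) / 10 ^ 16

namespace IsRegularSample

variable {x : Fin n → EuclideanSpace ℝ (Fin p)} {e : Fin n → ℝ}

/-- Markov's inequality for the counting measure. The truncation at `1` in the noise condition is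
what forces `c ≤ 1`. -/
lemma card_noise_mul_le (h : IsRegularSample x e) {τ c : ℝ} (hτ : τ ≤ 1 / 10 ^ 18) (hc : c ≤ 1) :
    ((Finset.univ.filter fun i => c < τ * e i ^ 2).card : ℝ) * c ≤ (n : ℝ) / 10 ^ 16 := by
  refine le_trans ?_ h.noise
  rw [← nsmul_eq_mul, ← Finset.sum_const]
  calc ∑ i ∈ Finset.univ.filter (fun i => c < τ * e i ^ 2), c
      ≤ ∑ i ∈ Finset.univ.filter (fun i => c < τ * e i ^ 2), min (1 / 10 ^ 18 * e i ^ 2) 1 := by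
        refine Finset.sum_le_sum fun i hi => le_min ?_ hc
        have := (Finset.mem_filter.1 hi).2
        have := mul_le_mul_of_nonneg_right hτ (sq_nonneg (e i))
        linarith
    _ ≤ _ := Finset.sum_le_sum_of_subset_of_nonneg (Finset.subset_univ _)
        fun i _ _ => le_min (by positivity) (by norm_num)

lemma card_inner_mul_le (h : IsRegularSample x e) {τ c : ℝ} (hτ : 0 ≤ τ)
    (u : EuclideanSpace ℝ (Fin p)) :
    ((Finset.univ.filter fun i => c < τ * inner ℝ (x i) u ^ 2).card : ℝ) * c
      ≤ 81 * (n : ℝ) * (τ * ‖u‖ ^ 2) := by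
  calc ((Finset.univ.filter fun i => c < τ * inner ℝ (x i) u ^ 2).card : ℝ) * c
      = ∑ i ∈ Finset.univ.filter (fun i => c < τ * inner ℝ (x i) u ^ 2), c := by
        rw [← nsmul_eq_mul, ← Finset.sum_const]
    _ ≤ ∑ i ∈ Finset.univ.filter (fun i => c < τ * inner ℝ (x i) u ^ 2),
          τ * inner ℝ (x i) u ^ 2 :=
        Finset.sum_le_sum fun i hi => (Finset.mem_filter.1 hi).2.le
    _ ≤ ∑ i, τ * inner ℝ (x i) u ^ 2 :=
        Finset.sum_le_sum_of_subset_of_nonneg (Finset.subset_univ _) fun i _ _ => by positivity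
    _ ≤ 81 * (n : ℝ) * (τ * ‖u‖ ^ 2) := by
        rw [← Finset.mul_sum]
        have := mul_le_mul_of_nonneg_left (h.upper u) hτ
        linarith

/-- A fixed proportion of the design vectors has a large inner product with `u`. -/
lemma card_large_ge (h : IsRegularSample x e) (u : EuclideanSpace ℝ (Fin p)) (hu : u ≠ 0) :
    (n : ℝ) / 12000 ≤
      ((Finset.univ.filter fun i => ‖u‖ ^ 2 / 4 ≤ inner ℝ (x i) u ^ 2).card : ℝ) := by
  -- Otherwise the large inner products contribute at most `n/12 ‖u‖²` and the others at most `n/4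
  -- ‖u‖²`, less than the lower bound `n/2 ‖u‖²`.
  by_contra! hlt
  have h1 := h.small _ hlt.le u
  have h2 : ∑ i ∈ Finset.univ.filter (fun i => ¬ ‖u‖ ^ 2 / 4 ≤ inner ℝ (x i) u ^ 2),
      inner ℝ (x i) u ^ 2 ≤ n * (‖u‖ ^ 2 / 4) := by
    calc _ ≤ ∑ i ∈ Finset.univ.filter (fun i => ¬ ‖u‖ ^ 2 / 4 ≤ inner ℝ (x i) u ^ 2),
          ‖u‖ ^ 2 / 4 := Finset.sum_le_sum fun i hi => (not_le.1 (Finset.mem_filter.1 hi).2).le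
      _ ≤ ∑ _i : Fin n, ‖u‖ ^ 2 / 4 := Finset.sum_le_sum_of_subset_of_nonneg
          (Finset.subset_univ _) fun i _ _ => by positivity
      _ = _ := by simp
  have h3 := h.lower u
  rw [← Finset.sum_filter_add_sum_filter_not Finset.univ
    (fun i => ‖u‖ ^ 2 / 4 ≤ inner ℝ (x i) u ^ 2)] at h3
  have hn : (0 : ℝ) < n := by exact_mod_cast h.pos
  have : 0 < (n : ℝ) * ‖u‖ ^ 2 := by positivity
  linarith

lemma sum_abs_inner_ge (h : IsRegularSample x e) (u : EuclideanSpace ℝ (Fin p)) :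
    (n : ℝ) / 24000 * ‖u‖ ≤ ∑ i, |(inner ℝ (x i) u : ℝ)| := by
  rcases eq_or_ne u 0 with rfl | hu
  · simp
  calc (n : ℝ) / 24000 * ‖u‖ = n / 12000 * (‖u‖ / 2) := by ring
    _ ≤ ((Finset.univ.filter fun i => ‖u‖ ^ 2 / 4 ≤ inner ℝ (x i) u ^ 2).card : ℝ)
          * (‖u‖ / 2) := mul_le_mul_of_nonneg_right (h.card_large_ge u hu) (by positivity)
    _ = ∑ i ∈ Finset.univ.filter (fun i => ‖u‖ ^ 2 / 4 ≤ inner ℝ (x i) u ^ 2), ‖u‖ / 2 := by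
        rw [Finset.sum_const, nsmul_eq_mul]
    _ ≤ ∑ i ∈ Finset.univ.filter (fun i => ‖u‖ ^ 2 / 4 ≤ inner ℝ (x i) u ^ 2),
          |(inner ℝ (x i) u : ℝ)| := by
        refine Finset.sum_le_sum fun i hi => ?_
        have := (Finset.mem_filter.1 hi).2
        apply le_of_sq_le_sq _ (abs_nonneg _)
        rw [sq_abs]
        linarith
    _ ≤ _ := Finset.sum_le_sum_of_subset_of_nonneg (Finset.subset_univ _)
        fun i _ _ => abs_nonneg _

/-- The gradient of the Welsch objective is strongly monotone near the true parameter. -/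
lemma strongly_monotone {y : Fin n → ℝ} {βs : EuclideanSpace ℝ (Fin p)}
    (h : IsRegularSample x fun i => y i - inner ℝ (x i) βs) {τ : ℝ} (hτ : 0 < τ)
    (hτ' : τ ≤ 1 / 10 ^ 18) {β γ : EuclideanSpace ℝ (Fin p)}
    (hβ : τ * ‖β - βs‖ ^ 2 ≤ 1 / (64 * 10 ^ 6)) (hγ : τ * ‖γ - βs‖ ^ 2 ≤ 1 / (64 * 10 ^ 6)) :
    1 / 8 * ‖β - γ‖ ^ 2 ≤
      inner ℝ (gradient (welschObjective τ x y) β - gradient (welschObjective τ x y) γ)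
        (β - γ) := by
  classical
  have hn : (0 : ℝ) < n := by exact_mod_cast h.pos
  rw [inner_gradient_sub hτ.ne']
  set B1 := Finset.univ.filter fun i => 1 / 16 < τ * (y i - inner ℝ (x i) βs) ^ 2 with hB1
  set B2 := Finset.univ.filter fun i => 1 / 16 < τ * inner ℝ (x i) (β - βs) ^ 2 with hB2
  set B3 := Finset.univ.filter fun i => 1 / 16 < τ * inner ℝ (x i) (γ - βs) ^ 2 with hB3
  have c1 := h.card_noise_mul_le hτ' (c := 1 / 16) (by norm_num)
  have c2 := h.card_inner_mul_le (c := 1 / 16) hτ.le (β - βs)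
  have c3 := h.card_inner_mul_le (c := 1 / 16) hτ.le (γ - βs)
  rw [← hB1] at c1
  rw [← hB2] at c2
  rw [← hB3] at c3
  have d2 := mul_le_mul_of_nonneg_left hβ (by positivity : (0 : ℝ) ≤ 81 * n)
  have d3 := mul_le_mul_of_nonneg_left hγ (by positivity : (0 : ℝ) ≤ 81 * n)
  set S := B1 ∪ B2 ∪ B3 with hS
  -- The three sets have at most `16n/10^16`, `16·81n/(64·10^6)` and `16·81n/(64·10^6)` elements.
  have hcard : (S.card : ℝ) ≤ n / 12000 := by
    have : (S.card : ℝ) ≤ B1.card + B2.card + B3.card := by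
      exact_mod_cast (Finset.card_union_le _ _).trans
        (add_le_add_left (Finset.card_union_le _ _) _)
    linarith
  have hsmall := h.small S hcard (β - γ)
  have hlow := h.lower (β - γ)
  set d : Fin n → ℝ := fun i => inner ℝ (x i) (β - γ) with hd
  set w : Fin n → ℝ := fun i => (welschInfluence τ (y i - inner ℝ (x i) γ) -
        welschInfluence τ (y i - inner ℝ (x i) β)) * inner ℝ (x i) (β - γ) with hw
  have hdiff : ∀ i, (y i - inner ℝ (x i) γ) - (y i - inner ℝ (x i) β) = d i := by
    intro i; simp only [hd, inner_sub_right]; ring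
  have hbad : ∀ i, -(d i ^ 2) ≤ w i := by
    intro i
    have h1 := abs_welschInfluence_sub_le hτ.le (y i - inner ℝ (x i) γ) (y i - inner ℝ (x i) β)
    rw [hdiff] at h1
    have h2 : |w i| ≤ d i ^ 2 := by
      rw [hw, abs_mul, ← sq_abs, sq]
      exact mul_le_mul_of_nonneg_right h1 (abs_nonneg _)
    exact (abs_le.1 h2).1
  have hgood : ∀ i, i ∉ S → 1 / 2 * d i ^ 2 ≤ w i := by
    intro i hi
    simp only [hS, hB1, hB2, hB3, Finset.mem_union, Finset.mem_filter, Finset.mem_univ, true_and,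
      not_or, not_lt] at hi
    obtain ⟨⟨h1, h2⟩, h3⟩ := hi
    have hr : ∀ ζ : EuclideanSpace ℝ (Fin p), τ * inner ℝ (x i) (ζ - βs) ^ 2 ≤ 1 / 16 →
        τ * (y i - inner ℝ (x i) ζ) ^ 2 ≤ 1 / 4 := by
      intro ζ hζ
      have e1 : y i - inner ℝ (x i) ζ = (y i - inner ℝ (x i) βs) - inner ℝ (x i) (ζ - βs) := by
        rw [inner_sub_right]; ring
      rw [e1]
      have := mul_nonneg hτ.le
        (sq_nonneg ((y i - inner ℝ (x i) βs) + inner ℝ (x i) (ζ - βs)))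
      nlinarith
    have := half_mul_sq_le_welschInfluence_sub_mul hτ.le (hr γ h3) (hr β h2)
    rwa [hdiff] at this
  -- With the isometry bounds, the left side is at least `(n/4 - n/8) ‖β - γ‖²`.
  have hsum : 1 / 2 * ∑ i, d i ^ 2 - 3 / 2 * ∑ i ∈ S, d i ^ 2 ≤ ∑ i, w i := by
    rw [← Finset.sum_add_sum_compl S (fun i => d i ^ 2), ← Finset.sum_add_sum_compl S w]
    have b1 : -∑ i ∈ S, d i ^ 2 ≤ ∑ i ∈ S, w i := by
      rw [← Finset.sum_neg_distrib]
      exact Finset.sum_le_sum fun i _ => hbad i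
    have b2 : 1 / 2 * ∑ i ∈ Sᶜ, d i ^ 2 ≤ ∑ i ∈ Sᶜ, w i := by
      rw [Finset.mul_sum]
      exact Finset.sum_le_sum fun i hi => hgood i (Finset.mem_compl.1 hi)
    linarith
  rw [one_div (n : ℝ), ← div_eq_inv_mul, le_div_iff₀ hn]
  linarith

/-- A linear map and its transpose have the same norm: pair the sum with itself and apply
Cauchy–Schwarz. -/
lemma norm_sum_smul_le (h : IsRegularSample x e) (c : Fin n → ℝ) :
    ‖∑ i, c i • x i‖ ^ 2 ≤ 81 * (n : ℝ) * ∑ i, c i ^ 2 := by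
  set g := ∑ i, c i • x i with hg
  have h1 : ‖g‖ ^ 2 = ∑ i, c i * inner ℝ (x i) g := by
    rw [← real_inner_self_eq_norm_sq]
    nth_rewrite 1 [hg]
    rw [sum_inner]
    simp only [inner_smul_left, conj_trivial]
  have h2 := Finset.sum_mul_sq_le_sq_mul_sq Finset.univ c (fun i => inner ℝ (x i) g)
  rw [← h1] at h2
  have h3 := h.upper g
  have h4 : 0 ≤ ∑ i, c i ^ 2 := Finset.sum_nonneg fun i _ => sq_nonneg _
  have h5 := mul_le_mul_of_nonneg_left h3 h4
  rcases (sq_nonneg ‖g‖).eq_or_lt with h0 | h0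
  · rw [← h0]; positivity
  · refine le_of_mul_le_mul_right ?_ h0
    nlinarith

lemma norm_gradient_sub_le {y : Fin n → ℝ} (h : IsRegularSample x e) {τ : ℝ} (hτ : 0 < τ)
    (β γ : EuclideanSpace ℝ (Fin p)) :
    ‖gradient (welschObjective τ x y) β - gradient (welschObjective τ x y) γ‖ ≤
      81 * ‖β - γ‖ := by
  have hn : (0 : ℝ) < n := by exact_mod_cast h.pos
  rw [gradient_welschObjective hτ.ne', gradient_welschObjective hτ.ne', ← smul_sub,
    ← Finset.sum_sub_distrib]
  simp only [← sub_smul]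
  rw [norm_smul, norm_neg, Real.norm_eq_abs, abs_of_pos (by positivity), one_div,
    ← div_eq_inv_mul, div_le_iff₀ hn]
  refine le_of_sq_le_sq ?_ (by positivity)
  refine (h.norm_sum_smul_le _).trans ?_
  have : ∑ i, (welschInfluence τ (y i - inner ℝ (x i) β) -
      welschInfluence τ (y i - inner ℝ (x i) γ)) ^ 2 ≤ ∑ i, inner ℝ (x i) (β - γ) ^ 2 := by
    refine Finset.sum_le_sum fun i _ => ?_
    have := abs_welschInfluence_sub_le hτ.le (y i - inner ℝ (x i) β) (y i - inner ℝ (x i) γ)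
    refine (sq_le_sq.2 this).trans (le_of_eq ?_)
    rw [inner_sub_right]; ring
  have h2 := mul_le_mul_of_nonneg_left (this.trans (h.upper (β - γ)))
    (by positivity : (0 : ℝ) ≤ 81 * n)
  refine h2.trans (le_of_eq (by ring))

end IsRegularSample

/-- Gradient descent with a small constant step size, for a nonnegative function whose gradient is
Lipschitz, is a descent method. -/
lemma isDescentRun_gradientDescent {f : EuclideanSpace ℝ (Fin p) → ℝ} {K η : ℝ}
    (hf : Differentiable ℝ f) (hf0 : ∀ β, 0 ≤ f β)
    (hK : ∀ β γ, ‖gradient f β - gradient f γ‖ ≤ K * ‖β - γ‖) (hη : 0 < η) (hηK : K * η ≤ 1 / 2)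
    (hK0 : 0 ≤ K) (β₀ : EuclideanSpace ℝ (Fin p)) :
    IsDescentRun f β₀ (gradientDescent f η β₀) := by
  set b := gradientDescent f η β₀ with hb
  have step : ∀ k, b (k + 1) = b k - η • gradient f (b k) := fun k => rfl
  -- By the mean value theorem the decrease is `η ⟨∇f(z), g⟩` for some `z` within `η ‖g‖` of `b k`,
  -- and `∇f(z)` differs from `g` by at most `K η ‖g‖ ≤ ‖g‖ / 2`.
  have dec : ∀ k, f (b (k + 1)) ≤ f (b k) - η / 2 * ‖gradient f (b k)‖ ^ 2 := by
    intro k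
    set g := gradient f (b k) with hg
    obtain ⟨z, hz, hfz⟩ := domain_mvt (f := f) (s := Set.univ) (x := b k) (y := b (k + 1))
      (f' := fun β => InnerProductSpace.toDual ℝ _ (gradient f β))
      (fun β _ => (hf β).hasGradientAt.hasFDerivAt.hasFDerivWithinAt) convex_univ
      (Set.mem_univ _) (Set.mem_univ _)
    have hd : b (k + 1) - b k = -(η • g) := by rw [step]; abel
    rw [hd] at hfz
    have hzd : ‖b k - z‖ ≤ η * ‖g‖ := by
      have h1 := norm_sub_le_of_mem_segment hz
      rw [norm_sub_rev] at h1
      rwa [hd, norm_neg, norm_smul, Real.norm_eq_abs, abs_of_pos hη] at h1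
    have h2 : inner ℝ (g - gradient f z) g ≤ K * (η * ‖g‖) * ‖g‖ :=
      (real_inner_le_norm _ _).trans (mul_le_mul_of_nonneg_right
        ((hK (b k) z).trans (mul_le_mul_of_nonneg_left hzd hK0)) (norm_nonneg _))
    rw [inner_sub_left, real_inner_self_eq_norm_sq] at h2
    simp only [InnerProductSpace.toDual_apply_apply, inner_neg_right, inner_smul_right] at hfz
    have h3 : ‖g‖ ^ 2 - inner ℝ (gradient f z) g ≤ 1 / 2 * ‖g‖ ^ 2 := by
      refine h2.trans ?_
      have := mul_le_mul_of_nonneg_right hηK (sq_nonneg ‖g‖)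
      linarith
    have := mul_le_mul_of_nonneg_left h3 hη.le
    linarith
  refine ⟨rfl, fun k => (dec k).trans (sub_le_self _ (by positivity)), ?_⟩
  have anti : Antitone fun k => f (b k) :=
    antitone_nat_of_succ_le fun k => (dec k).trans (sub_le_self _ (by positivity))
  have lim := tendsto_atTop_ciInf anti ⟨0, by rintro _ ⟨k, rfl⟩; exact hf0 _⟩
  have lim2 := (lim.sub (lim.comp (tendsto_add_atTop_nat 1))).const_mul (2 / η)
  rw [sub_self, mul_zero] at lim2
  have lim3 : Tendsto (fun k => ‖gradient f (b k)‖ ^ 2) atTop (𝓝 0) := by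
    refine squeeze_zero (fun k => by positivity) (fun k => ?_) lim2
    have := dec k
    simp only [Function.comp]
    rw [div_mul_eq_mul_div, le_div_iff₀ hη]
    linarith
  rw [tendsto_zero_iff_norm_tendsto_zero]
  have := (Real.continuous_sqrt.tendsto 0).comp lim3
  simpa [Function.comp_def, Real.sqrt_sq (norm_nonneg _)] using this

lemma continuous_ladObjective (x : Fin n → EuclideanSpace ℝ (Fin p)) (y : Fin n → ℝ) :
    Continuous (ladObjective x y) := by
  unfold ladObjective
  fun_prop

lemma eventually_cocompact_le_norm_sub {E : Type*} [NormedAddCommGroup E] [ProperSpace E] (R : ℝ)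
    (b : E) : ∀ᶠ β in cocompact E, R ≤ ‖β - b‖ := by
  filter_upwards [(tendsto_norm_cocompact_atTop (E := E)).eventually_ge_atTop (R + ‖b‖)] with β hβ
  have := norm_sub_norm_le β b
  linarith

namespace IsRegularSample

variable {x : Fin n → EuclideanSpace ℝ (Fin p)} {y : Fin n → ℝ} {βs : EuclideanSpace ℝ (Fin p)}

/-- By the triangle inequality and `sum_abs_inner_ge`, the LAD objective grows linearly away from
`βs`, so it is coercive. -/
lemma exists_isLADEstimate (h : IsRegularSample x fun i => y i - inner ℝ (x i) βs) :
    ∃ β, IsLADEstimate x y 0 β := by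
  have hn : (0 : ℝ) < n := by exact_mod_cast h.pos
  obtain ⟨β, hβ⟩ := (continuous_ladObjective x y).exists_forall_le' βs (by
    filter_upwards [eventually_cocompact_le_norm_sub (2 * ladObjective x y βs / (n / 24000)) βs]
      with β hβ
    rw [div_le_iff₀ (by positivity)] at hβ
    have h1 := h.sum_abs_inner_ge (β - βs)
    have h2 : ∑ i, |(inner ℝ (x i) (β - βs) : ℝ)| ≤ ladObjective x y β + ladObjective x y βs := by
      unfold ladObjective
      rw [← Finset.sum_add_distrib]
      refine Finset.sum_le_sum fun i _ => ?_
      have : (inner ℝ (x i) (β - βs) : ℝ) = -(y i - inner ℝ (x i) β) + (y i - inner ℝ (x i) βs) := by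
        rw [inner_sub_right]; ring
      rw [this]
      refine (abs_add_le _ _).trans ?_
      rw [abs_neg]
    linarith)
  exact ⟨β, fun β' => by simpa using hβ β'⟩

/-- LAD estimates, even approximate ones, are within constant distance of the true parameter. -/
lemma norm_sub_le_of_isLADEstimate (h : IsRegularSample x fun i => y i - inner ℝ (x i) βs)
    {ε : ℝ} (hε : ε ≤ 1) {β : EuclideanSpace ℝ (Fin p)} (hβ : IsLADEstimate x y ε β) :
    ‖β - βs‖ ≤ 10 ^ 14 := by
  have hn : (0 : ℝ) < n := by exact_mod_cast h.pos
  set u := β - βs with hu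
  set e : Fin n → ℝ := fun i => y i - inner ℝ (x i) βs with he
  set B := Finset.univ.filter fun i => 1 < 1 / 10 ^ 18 * e i ^ 2 with hB
  have hcard : (B.card : ℝ) ≤ (n : ℝ) / 10 ^ 16 := by
    have := h.card_noise_mul_le (τ := 1 / 10 ^ 18) (c := 1) le_rfl le_rfl
    rwa [mul_one] at this
  have hsB : ∑ i ∈ B, |(inner ℝ (x i) u : ℝ)| ≤ 9 * n * ‖u‖ / 10 ^ 8 := by
    refine le_of_sq_le_sq ?_ (by positivity)
    have h1 := Finset.sum_mul_sq_le_sq_mul_sq B (fun _ => (1 : ℝ)) fun i => |(inner ℝ (x i) u : ℝ)|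
    simp only [one_mul, one_pow, Finset.sum_const, nsmul_eq_mul, mul_one, sq_abs] at h1
    refine h1.trans ?_
    have h2 : ∑ i ∈ B, inner ℝ (x i) u ^ 2 ≤ 81 * (n : ℝ) * ‖u‖ ^ 2 :=
      (Finset.sum_le_sum_of_subset_of_nonneg (Finset.subset_univ _)
        fun i _ _ => sq_nonneg _).trans (h.upper u)
    refine (mul_le_mul hcard h2 (Finset.sum_nonneg fun i _ => sq_nonneg _)
      (by positivity)).trans (le_of_eq (by ring))
  -- With `d = ⟨x i, u⟩`, use `|e - d| - |e| ≥ |d| - 2|e|` where `|e| ≤ 10^9`, and `≥ -|d|` on the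
  -- few remaining indices `B`.
  have hsum : ∑ i, |(inner ℝ (x i) u : ℝ)| - 2 * 10 ^ 9 * n
      - 2 * ∑ i ∈ B, |(inner ℝ (x i) u : ℝ)| ≤ ladObjective x y β - ladObjective x y βs := by
    unfold ladObjective
    rw [← Finset.sum_sub_distrib, ← Finset.sum_filter_add_sum_filter_not Finset.univ
      (fun i => 1 < 1 / 10 ^ 18 * e i ^ 2) (fun i => |y i - inner ℝ (x i) β| - _),
      ← Finset.sum_filter_add_sum_filter_not Finset.univ
      (fun i => 1 < 1 / 10 ^ 18 * e i ^ 2) (fun i => |(inner ℝ (x i) u : ℝ)|)]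
    have hr : ∀ i, y i - inner ℝ (x i) β = e i - inner ℝ (x i) u := by
      intro i; simp only [he, hu, inner_sub_right]; ring
    have b1 : -∑ i ∈ B, |(inner ℝ (x i) u : ℝ)| ≤
        ∑ i ∈ B, (|y i - inner ℝ (x i) β| - |y i - inner ℝ (x i) βs|) := by
      rw [← Finset.sum_neg_distrib]
      refine Finset.sum_le_sum fun i _ => ?_
      rw [hr]
      have : |e i| ≤ |e i - inner ℝ (x i) u| + |(inner ℝ (x i) u : ℝ)| := by
        simpa using abs_add_le (e i - inner ℝ (x i) u) (inner ℝ (x i) u)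
      change _ ≤ _ - |e i|
      linarith
    have b2 : ∑ i ∈ Finset.univ.filter (fun i => ¬ 1 < 1 / 10 ^ 18 * e i ^ 2),
          |(inner ℝ (x i) u : ℝ)| - 2 * 10 ^ 9 * n ≤
        ∑ i ∈ Finset.univ.filter (fun i => ¬ 1 < 1 / 10 ^ 18 * e i ^ 2),
          (|y i - inner ℝ (x i) β| - |y i - inner ℝ (x i) βs|) := by
      have hc : ∑ i ∈ Finset.univ.filter (fun i => ¬ 1 < 1 / 10 ^ 18 * e i ^ 2),
          (2 * 10 ^ 9 : ℝ) ≤ 2 * 10 ^ 9 * n := by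
        refine (Finset.sum_le_sum_of_subset_of_nonneg (Finset.subset_univ _)
          fun i _ _ => by norm_num).trans (le_of_eq ?_)
        simp [mul_comm]
      refine (sub_le_sub_left hc _).trans ?_
      rw [← Finset.sum_sub_distrib]
      refine Finset.sum_le_sum fun i hi => ?_
      have h1 := not_lt.1 (Finset.mem_filter.1 hi).2
      have h2 : |e i| ≤ 10 ^ 9 := by
        refine abs_le_of_sq_le_sq ?_ (by positivity)
        rw [one_div, inv_mul_le_iff₀ (by positivity)] at h1
        linarith
      rw [hr]
      change _ ≤ _ - |e i|
      have h3 : |(inner ℝ (x i) u : ℝ)| ≤ |e i| + |e i - inner ℝ (x i) u| := by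
        have := abs_sub (e i) (e i - inner ℝ (x i) u)
        rwa [sub_sub_cancel] at this
      linarith
    rw [← hB]
    linarith
  have h1 := h.sum_abs_inner_ge u
  have h2 := hβ βs
  have h3 := mul_le_mul_of_nonneg_right hε hn.le
  -- The slope `1/24000 - 18/10^8` exceeds `4·10^(-5)`, while the constant terms total at most
  -- `(2·10^9 + 1) n`.
  by_contra! hlt
  have := mul_lt_mul_of_pos_left hlt hn
  linarith

lemma welschLoss_sub_le {τ : ℝ} (hτ : 0 < τ) (a b : ℝ) :
    welschLoss τ (a - b) ≤ 1 / τ * (min (τ * a ^ 2) 1 + τ * b ^ 2) := by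
  unfold welschLoss
  refine mul_le_mul_of_nonneg_left ?_ (by positivity)
  have h1 := Real.add_one_le_exp (-τ * (a - b) ^ 2 / 2)
  have h2 := Real.exp_pos (-τ * (a - b) ^ 2 / 2)
  have h3 : 0 ≤ τ * b ^ 2 := by positivity
  have h4 : 0 ≤ τ * (a + b) ^ 2 := by positivity
  rcases min_choice (τ * a ^ 2) 1 with h | h <;> rw [h] <;> nlinarith

/-- The Welsch objective is larger far from the true parameter than at any potential starting
point. -/
lemma welschObjective_lt (h : IsRegularSample x fun i => y i - inner ℝ (x i) βs) {τ : ℝ}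
    (hτ : 0 < τ) (hτ' : τ ≤ 1 / 10 ^ 45) {β γ : EuclideanSpace ℝ (Fin p)}
    (hγ : ‖γ - βs‖ ≤ 10 ^ 14) (hβ : 1 / (64 * 10 ^ 6) < τ * ‖β - βs‖ ^ 2) :
    welschObjective τ x y γ < welschObjective τ x y β := by
  classical
  have hn : (0 : ℝ) < n := by exact_mod_cast h.pos
  have hτ18 : τ ≤ 1 / 10 ^ 18 := hτ'.trans (by norm_num)
  set e : Fin n → ℝ := fun i => y i - inner ℝ (x i) βs with he
  have hr : ∀ ζ : EuclideanSpace ℝ (Fin p), ∀ i,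
      y i - inner ℝ (x i) ζ = e i - inner ℝ (x i) (ζ - βs) := by
    intro ζ i; simp only [he, inner_sub_right]; ring
  -- Here the size of `τ` matters: `τ ≤ 10^(-45)` offsets the squared radius `10^28` of the LAD
  -- ball.
  have up : ∑ i, welschLoss τ (y i - inner ℝ (x i) γ) ≤ 1 / τ * (n / 10 ^ 15) := by
    calc ∑ i, welschLoss τ (y i - inner ℝ (x i) γ)
        ≤ ∑ i, 1 / τ * (min (1 / 10 ^ 18 * e i ^ 2) 1 + τ * inner ℝ (x i) (γ - βs) ^ 2) := by
          refine Finset.sum_le_sum fun i _ => ?_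
          rw [hr]
          refine (welschLoss_sub_le hτ _ _).trans ?_
          gcongr
      _ = 1 / τ * (∑ i, min (1 / 10 ^ 18 * e i ^ 2) 1
            + τ * ∑ i, inner ℝ (x i) (γ - βs) ^ 2) := by
          rw [← Finset.mul_sum, Finset.sum_add_distrib, Finset.mul_sum]
      _ ≤ 1 / τ * (n / 10 ^ 16 + 1 / 10 ^ 45 * (81 * n * (10 ^ 14) ^ 2)) := by
          have h1 := h.noise
          have h2 : ∑ i, inner ℝ (x i) (γ - βs) ^ 2 ≤ 81 * (n : ℝ) * (10 ^ 14) ^ 2 :=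
            (h.upper (γ - βs)).trans (by gcongr)
          have h3 : 0 ≤ ∑ i, inner ℝ (x i) (γ - βs) ^ 2 :=
            Finset.sum_nonneg fun i _ => sq_nonneg _
          gcongr
      _ ≤ 1 / τ * (n / 10 ^ 15) := by
          refine mul_le_mul_of_nonneg_left ?_ (by positivity)
          linarith
  have hu : β - βs ≠ 0 := by
    intro h0
    rw [h0] at hβ
    norm_num at hβ
  -- On `A \ B` the inner product is at least twice the noise level in absolute value, so the
  -- residual stays of order `τ^{-1/2}` and each loss is at least a fixed multiple of `1/τ`.
  set A := Finset.univ.filter fun i => ‖β - βs‖ ^ 2 / 4 ≤ inner ℝ (x i) (β - βs) ^ 2 with hA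
  set B := Finset.univ.filter fun i => 1 / (1024 * 10 ^ 6) < τ * e i ^ 2 with hB
  have cA : (n : ℝ) / 12000 ≤ A.card := h.card_large_ge _ hu
  have cB := h.card_noise_mul_le hτ18 (c := 1 / (1024 * 10 ^ 6)) (by norm_num)
  have cAB : (n : ℝ) / 24000 ≤ (A \ B).card := by
    have h1 : (A.card : ℝ) ≤ (A \ B).card + B.card := by
      exact_mod_cast Finset.card_le_card_sdiff_add_card
    change (B.card : ℝ) * _ ≤ _ at cB
    linarith
  have low : 1 / τ * ((n : ℝ) / 24000 * (1 / (4096 * 10 ^ 6))) ≤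
      ∑ i, welschLoss τ (y i - inner ℝ (x i) β) := by
    calc 1 / τ * ((n : ℝ) / 24000 * (1 / (4096 * 10 ^ 6)))
        ≤ 1 / τ * ((A \ B).card * (1 / (4096 * 10 ^ 6))) := by gcongr
      _ = ∑ i ∈ A \ B, 1 / τ * (1 / (4096 * 10 ^ 6)) := by
          rw [Finset.sum_const, nsmul_eq_mul]; ring
      _ ≤ ∑ i ∈ A \ B, welschLoss τ (y i - inner ℝ (x i) β) := by
          refine Finset.sum_le_sum fun i hi => ?_
          unfold welschLoss
          refine mul_le_mul_of_nonneg_left ?_ (by positivity)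
          obtain ⟨hiA, hiB⟩ := Finset.mem_sdiff.1 hi
          have h1 := (Finset.mem_filter.1 hiA).2
          have h2 : τ * e i ^ 2 ≤ 1 / (1024 * 10 ^ 6) := by
            by_contra! hcon
            exact hiB (Finset.mem_filter.2 ⟨Finset.mem_univ _, hcon⟩)
          rw [hr]
          set d : ℝ := inner ℝ (x i) (β - βs) with hd
          have h3 : 1 / (256 * 10 ^ 6) ≤ τ * d ^ 2 := by
            have := mul_le_mul_of_nonneg_left h1 hτ.le
            linarith
          have h4 : 1 / (1024 * 10 ^ 6) ≤ τ * (e i - d) ^ 2 := by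
            have : 0 ≤ τ * (2 * e i - d) ^ 2 := by positivity
            nlinarith
          have h5 : Real.exp (-τ * (e i - d) ^ 2 / 2) ≤ Real.exp (-(1 / (2048 * 10 ^ 6))) :=
            Real.exp_le_exp.2 (by linarith)
          have h6 : Real.exp (-(1 / (2048 * 10 ^ 6) : ℝ)) ≤ 1 - 1 / (4096 * 10 ^ 6) := by
            rw [Real.exp_neg]
            have := Real.add_one_le_exp (1 / (2048 * 10 ^ 6) : ℝ)
            rw [inv_le_comm₀ (Real.exp_pos _) (by norm_num)]
            refine le_trans ?_ this
            norm_num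
          linarith
      _ ≤ _ := Finset.sum_le_sum_of_subset_of_nonneg (Finset.subset_univ _)
          fun i _ _ => welschLoss_nonneg hτ _
  unfold welschObjective
  refine mul_lt_mul_of_pos_left (up.trans_lt (lt_of_lt_of_le ?_ low)) (by positivity)
  refine mul_lt_mul_of_pos_left ?_ (by positivity)
  linarith

/-- On a regular sample the Welsch objective has a unique minimizer, to which the two-stage
algorithm converges, and whose error is bounded by the gradient at the true parameter. -/
theorem exists_minimizer (h : IsRegularSample x fun i => y i - inner ℝ (x i) βs) {τ : ℝ}
    (hτ : 0 < τ) (hτ' : τ ≤ 1 / 10 ^ 45) :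
    ∃ βhat : EuclideanSpace ℝ (Fin p),
      (∀ β, β ≠ βhat → welschObjective τ x y βhat < welschObjective τ x y β) ∧
      (∀ ε ∈ Set.Icc (0 : ℝ) 1, ∀ β₀, IsLADEstimate x y ε β₀ →
        (∀ b, IsDescentRun (welschObjective τ x y) β₀ b → Tendsto b atTop (𝓝 βhat)) ∧
        (∀ η, 0 < η → η ≤ 1 / 162 →
          Tendsto (gradientDescent (welschObjective τ x y) η β₀) atTop (𝓝 βhat))) ∧
      ‖βhat - βs‖ ≤ 8 * ‖gradient (welschObjective τ x y) βs‖ := by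
  set f := welschObjective τ x y with hf
  have hτ18 : τ ≤ 1 / 10 ^ 18 := hτ'.trans (by norm_num)
  have near : ∀ β γ : EuclideanSpace ℝ (Fin p), ‖γ - βs‖ ≤ 10 ^ 14 → f β ≤ f γ →
      τ * ‖β - βs‖ ^ 2 ≤ 1 / (64 * 10 ^ 6) := by
    intro β γ hγ hle
    by_contra! hlt
    exact (h.welschObjective_lt hτ hτ' hγ hlt).not_ge hle
  have h0 : ‖βs - βs‖ ≤ 10 ^ 14 := by simp
  obtain ⟨βhat, hmin⟩ := (continuous_welschObjective hτ.ne' x y).exists_forall_le' βs (by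
    filter_upwards [eventually_cocompact_le_norm_sub (1 / τ + 1) βs] with β hβ
    refine (h.welschObjective_lt hτ hτ' h0 ?_).le
    have h1 : 1 ≤ τ * ‖β - βs‖ := by
      have := mul_le_mul_of_nonneg_left hβ hτ.le
      rw [mul_add, mul_one_div_cancel hτ.ne'] at this
      linarith
    have h2 : 1 ≤ ‖β - βs‖ := by
      have : 0 < 1 / τ := by positivity
      linarith
    nlinarith)
  have grad0 : ∀ β, (∀ γ, f β ≤ f γ) → gradient f β = 0 := by
    intro β hβ
    have h1 : IsLocalMin f β := Filter.Eventually.of_forall hβ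
    have h2 := h1.fderiv_eq_zero
    rw [gradient, h2, map_zero]
  have hhat0 := grad0 βhat hmin
  have hhat := near βhat βs h0 (hmin βs)
  -- Strong monotonicity against `βhat`, where the gradient vanishes, and Cauchy–Schwarz.
  have dist_le : ∀ β, τ * ‖β - βs‖ ^ 2 ≤ 1 / (64 * 10 ^ 6) →
      ‖β - βhat‖ ≤ 8 * ‖gradient f β‖ := by
    intro β hβ
    have h1 := h.strongly_monotone hτ hτ18 hβ hhat
    rw [← hf, hhat0, sub_zero] at h1
    have h2 := h1.trans (real_inner_le_norm _ _)
    rcases (norm_nonneg (β - βhat)).eq_or_lt with h3 | h3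
    · rw [← h3]; positivity
    · refine le_of_mul_le_mul_right ?_ h3
      linarith
  have conv : ∀ ε ∈ Set.Icc (0 : ℝ) 1, ∀ β₀, IsLADEstimate x y ε β₀ →
      ∀ b, IsDescentRun f β₀ b → Tendsto b atTop (𝓝 βhat) := by
    intro ε hε β₀ hβ₀ b hb
    have hstart := h.norm_sub_le_of_isLADEstimate hε.2 hβ₀
    have hle : ∀ k, f (b k) ≤ f β₀ := by
      intro k
      rw [← hb.start]
      exact antitone_nat_of_succ_le (f := fun k => f (b k)) hb.descent (Nat.zero_le k)
    rw [tendsto_iff_norm_sub_tendsto_zero]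
    have hlim := (hb.stationary.norm.const_mul 8)
    rw [norm_zero, mul_zero] at hlim
    exact squeeze_zero (fun _ => norm_nonneg _)
      (fun k => dist_le _ (near _ _ hstart (hle k))) hlim
  refine ⟨βhat, ?_, ?_, ?_⟩
  · intro β hne
    by_contra! hle
    have hβmin : ∀ γ, f β ≤ f γ := fun γ => hle.trans (hmin γ)
    have := dist_le β (near β βs h0 (hβmin βs))
    rw [grad0 β hβmin, norm_zero, mul_zero] at this
    exact hne (sub_eq_zero.1 (norm_le_zero_iff.1 this))
  · intro ε hε β₀ hβ₀
    refine ⟨conv ε hε β₀ hβ₀, fun η hη hη' => conv ε hε β₀ hβ₀ _ ?_⟩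
    refine isDescentRun_gradientDescent (K := 81)
      (fun β => (hasGradientAt_welschObjective hτ.ne' x y β).differentiableAt)
      (welschObjective_nonneg hτ x y) (h.norm_gradient_sub_le hτ) hη (by linarith)
      (by norm_num) β₀
  · rw [norm_sub_rev]
    exact dist_le βs (by simp)

end IsRegularSample

end Deterministic

/-! ### Chernoff's bound -/

/-- Chernoff's bound for sums of independent random variables, in terms of bounds for the
exponential moments. -/
lemma measure_sum_ge_le_exp_neg {Ω ι : Type*} [MeasurableSpace Ω] [Fintype ι] {μ : Measure Ω}
    {Z : ι → Ω → ℝ} {c : ι → ℝ} (hm : ∀ i, Measurable (Z i)) (hind : iIndepFun Z μ)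
    (hexp : ∀ i, ∫⁻ ω, ENNReal.ofReal (Real.exp (Z i ω)) ∂μ ≤ ENNReal.ofReal (Real.exp (c i)))
    (t : ℝ) :
    μ {ω | ∑ i, c i + t ≤ ∑ i, Z i ω} ≤ ENNReal.ofReal (Real.exp (-t)) := by
  have hprod : ∫⁻ ω, ENNReal.ofReal (Real.exp (∑ i, Z i ω)) ∂μ ≤
      ENNReal.ofReal (Real.exp (∑ i, c i)) := by
    have h1 : ∀ ω, ENNReal.ofReal (Real.exp (∑ i, Z i ω)) =
        ∏ i, ENNReal.ofReal (Real.exp (Z i ω)) := by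
      intro ω
      rw [Real.exp_sum, ENNReal.ofReal_prod_of_nonneg fun i _ => (Real.exp_pos _).le]
    simp_rw [h1]
    have hind' : iIndepFun (fun i ω => ENNReal.ofReal (Real.exp (Z i ω))) μ :=
      hind.comp (fun _ z => ENNReal.ofReal (Real.exp z)) (fun _ => by fun_prop)
    rw [lintegral_prod_eq_prod_lintegral_of_indepFun Finset.univ _ hind'
      (fun i => by have := hm i; fun_prop), Real.exp_sum,
      ENNReal.ofReal_prod_of_nonneg fun i _ => (Real.exp_pos _).le]
    exact Finset.prod_le_prod' fun i _ => hexp i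
  have hmeas : Measurable fun ω => ENNReal.ofReal (Real.exp (∑ i, Z i ω)) := by fun_prop
  calc μ {ω | ∑ i, c i + t ≤ ∑ i, Z i ω}
      ≤ μ {ω | ENNReal.ofReal (Real.exp (∑ i, c i + t)) ≤
          ENNReal.ofReal (Real.exp (∑ i, Z i ω))} :=
        measure_mono fun ω hω => ENNReal.ofReal_le_ofReal (Real.exp_le_exp.2 hω)
    _ ≤ (∫⁻ ω, ENNReal.ofReal (Real.exp (∑ i, Z i ω)) ∂μ) /
          ENNReal.ofReal (Real.exp (∑ i, c i + t)) :=
        meas_ge_le_lintegral_div hmeas.aemeasurable (by simp [Real.exp_pos]) ENNReal.ofReal_ne_top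
    _ ≤ ENNReal.ofReal (Real.exp (∑ i, c i)) / ENNReal.ofReal (Real.exp (∑ i, c i + t)) := by
        gcongr
    _ = ENNReal.ofReal (Real.exp (-t)) := by
        rw [← ENNReal.ofReal_div_of_pos (Real.exp_pos _), ← Real.exp_sub]
        congr 2; ring

/-! ### Nets of the unit ball and discretization of operator norms -/

section Net

variable {E F : Type*} [NormedAddCommGroup E] [NormedSpace ℝ E]
  [NormedAddCommGroup F] [NormedSpace ℝ F]

/-- Without such a net, `1`-separated sets in the ball of radius `2` could be enlarged greedily for
ever, but they have at most `5 ^ d` points. Halving their points turns separation `1` into covering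
radius `1/2`. -/
lemma exists_half_net (E : Type*) [NormedAddCommGroup E] [NormedSpace ℝ E]
    [FiniteDimensional ℝ E] : ∃ N : Finset E, N.card ≤ 5 ^ Module.finrank ℝ E ∧
    ∀ u : E, ‖u‖ ≤ 1 → ∃ v ∈ N, ‖u - v‖ ≤ 1 / 2 := by
  classical
  by_contra! hcon
  have sep : ∀ k : ℕ, ∃ s : Finset E, s.card = k ∧ (∀ c ∈ s, ‖c‖ ≤ 2) ∧
      ∀ c ∈ s, ∀ d ∈ s, c ≠ d → 1 ≤ ‖c - d‖ := by
    intro k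
    induction k with
    | zero => exact ⟨∅, by simp⟩
    | succ k ih =>
      obtain ⟨s, rfl, hs, hs'⟩ := ih
      obtain ⟨u, hu, hu'⟩ := hcon (s.image fun c => (1 / 2 : ℝ) • c)
        (Finset.card_image_le.trans (Besicovitch.card_le_of_separated s hs hs'))
      have hfar : ∀ c ∈ s, 1 ≤ ‖(2 : ℝ) • u - c‖ := by
        intro c hc
        have h1 := hu' _ (Finset.mem_image_of_mem _ hc)
        have h2 : (2 : ℝ) • u - c = (2 : ℝ) • (u - (1 / 2 : ℝ) • c) := by
          rw [smul_sub, smul_smul]; norm_num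
        rw [h2, norm_smul]
        norm_num at h1 ⊢
        linarith
      have hnot : (2 : ℝ) • u ∉ s := fun hmem => by
        have := hfar _ hmem
        norm_num at this
      refine ⟨insert ((2 : ℝ) • u) s, Finset.card_insert_of_notMem hnot, ?_, ?_⟩
      · intro c hc
        rcases Finset.mem_insert.1 hc with rfl | hc
        · rw [norm_smul]; norm_num; linarith
        · exact hs c hc
      · intro c hc d hd hne
        rcases Finset.mem_insert.1 hc with rfl | hc <;> rcases Finset.mem_insert.1 hd with rfl | hd
        · exact absurd rfl hne
        · exact hfar d hd
        · rw [norm_sub_rev]; exact hfar c hc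
        · exact hs' c hc d hd hne
  obtain ⟨s, hcard, hs, hs'⟩ := sep (5 ^ Module.finrank ℝ E + 1)
  have := Besicovitch.card_le_of_separated s hs hs'
  omega

/-- Cover each ball of radius `2^{-k}` by a scaled copy of the half net. -/
lemma exists_net (E : Type*) [NormedAddCommGroup E] [NormedSpace ℝ E]
    [FiniteDimensional ℝ E] (k : ℕ) : ∃ N : Finset E, N.card ≤ (5 ^ Module.finrank ℝ E) ^ k ∧
    ∀ u : E, ‖u‖ ≤ 1 → ∃ v ∈ N, ‖u - v‖ ≤ (1 / 2) ^ k := by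
  classical
  induction k with
  | zero => exact ⟨{0}, by simp, fun u hu => ⟨0, by simp, by simpa using hu⟩⟩
  | succ k ih =>
    obtain ⟨N, hN, hnet⟩ := ih
    obtain ⟨M, hM, hM'⟩ := exists_half_net E
    refine ⟨(N ×ˢ M).image fun z => z.1 + ((1 / 2 : ℝ) ^ k) • z.2, ?_, fun u hu => ?_⟩
    · refine Finset.card_image_le.trans ?_
      rw [Finset.card_product, pow_succ]
      exact Nat.mul_le_mul hN hM
    · obtain ⟨v, hv, huv⟩ := hnet u hu
      obtain ⟨w, hw, hvw⟩ := hM' ((2 : ℝ) ^ k • (u - v)) (by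
        rw [norm_smul, norm_pow]
        calc ‖(2 : ℝ)‖ ^ k * ‖u - v‖ ≤ ‖(2 : ℝ)‖ ^ k * (1 / 2) ^ k := by gcongr
          _ = 1 := by rw [← mul_pow]; norm_num)
      refine ⟨v + ((1 / 2 : ℝ) ^ k) • w,
        Finset.mem_image.2 ⟨(v, w), Finset.mem_product.2 ⟨hv, hw⟩, rfl⟩, ?_⟩
      have h1 : u - (v + ((1 / 2 : ℝ) ^ k) • w) =
          ((1 / 2 : ℝ) ^ k) • ((2 : ℝ) ^ k • (u - v) - w) := by
        rw [smul_sub, smul_smul, ← mul_pow]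
        norm_num
        abel
      rw [h1, norm_smul, pow_succ]
      have : ‖((1 / 2 : ℝ) ^ k)‖ = (1 / 2) ^ k := by simp
      rw [this]
      gcongr

/-- Net points need not lie in the unit ball, only in the ball of radius `3/2`. So `‖A‖ ≤ 3b/2 +
‖A‖/2`. -/
lemma ContinuousLinearMap.opNorm_le_of_half_net (A : E →L[ℝ] F) {N : Finset E} {b : ℝ}
    (hb : 0 ≤ b) (hnet : ∀ u : E, ‖u‖ ≤ 1 → ∃ v ∈ N, ‖u - v‖ ≤ 1 / 2)
    (hN : ∀ v ∈ N, ‖A v‖ ≤ b * ‖v‖) : ‖A‖ ≤ 3 * b := by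
  have h : ‖A‖ ≤ 3 / 2 * b + ‖A‖ / 2 := by
    refine A.opNorm_le_of_unit_norm (by positivity) fun u hu => ?_
    obtain ⟨v, hv, huv⟩ := hnet u hu.le
    have h1 : ‖v‖ ≤ 3 / 2 := by
      have := norm_sub_norm_le v u
      rw [norm_sub_rev, hu] at this
      linarith
    calc ‖A u‖ = ‖A v + A (u - v)‖ := by rw [← map_add]; congr 2; abel
      _ ≤ ‖A v‖ + ‖A (u - v)‖ := norm_add_le _ _
      _ ≤ b * (3 / 2) + ‖A‖ * (1 / 2) := by
          refine add_le_add ((hN v hv).trans (by gcongr)) ((A.le_opNorm _).trans (by gcongr))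
      _ = _ := by ring
  linarith

lemma ContinuousLinearMap.norm_apply_ge_of_net (A : E →L[ℝ] F) {N : Finset E} {b K ε : ℝ}
    (hb : 0 ≤ b) (hA : ‖A‖ ≤ K) (hnet : ∀ u : E, ‖u‖ ≤ 1 → ∃ v ∈ N, ‖u - v‖ ≤ ε)
    (hN : ∀ v ∈ N, b * ‖v‖ ≤ ‖A v‖) (u : E) : (b * (1 - ε) - K * ε) * ‖u‖ ≤ ‖A u‖ := by
  have unit : ∀ u : E, ‖u‖ = 1 → b * (1 - ε) - K * ε ≤ ‖A u‖ := by
    intro u hu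
    obtain ⟨v, hv, huv⟩ := hnet u hu.le
    have h1 : 1 - ε ≤ ‖v‖ := by
      have := norm_sub_norm_le u v
      rw [hu] at this
      linarith
    have h2 : ‖A v‖ ≤ ‖A u‖ + ‖A (u - v)‖ := by
      rw [map_sub]
      have := norm_sub_norm_le (A v) (A u)
      rw [norm_sub_rev] at this
      linarith
    have h3 : ‖A (u - v)‖ ≤ K * ε := (A.le_opNorm _).trans
      (mul_le_mul hA huv (norm_nonneg _) ((norm_nonneg _).trans hA))
    have h4 := (mul_le_mul_of_nonneg_left h1 hb).trans (hN v hv)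
    linarith
  rcases eq_or_ne u 0 with rfl | hu
  · simp
  · have h1 := unit (‖u‖⁻¹ • u) (by rw [norm_smul, norm_inv, norm_norm,
      inv_mul_cancel₀ (norm_ne_zero_iff.2 hu)])
    rw [map_smul, norm_smul, norm_inv, norm_norm, inv_mul_eq_div,
      le_div_iff₀ (norm_pos_iff.2 hu)] at h1
    exact h1

end Net

/-! ### The design as a linear map -/

section Design

variable {ι : Type*} {E : Type*} [NormedAddCommGroup E] [InnerProductSpace ℝ E]

/-- The linear map whose components are the inner products with the vectors `x i`, `i ∈ S`. -/
noncomputable def designMap (x : ι → E) (S : Finset ι) : E →L[ℝ] EuclideanSpace ℝ S :=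
  (EuclideanSpace.equiv S ℝ).symm.toContinuousLinearMap.comp
    (ContinuousLinearMap.pi fun i : S => innerSL ℝ (x i))

lemma norm_designMap_sq (x : ι → E) (S : Finset ι) (u : E) :
    ‖designMap x S u‖ ^ 2 = ∑ i ∈ S, inner ℝ (x i) u ^ 2 := by
  rw [EuclideanSpace.norm_sq_eq, ← Finset.sum_coe_sort S]
  refine Finset.sum_congr rfl fun i _ => ?_
  rw [Real.norm_eq_abs, sq_abs]
  rfl

lemma norm_designMap_le_of_net (x : ι → E) (S : Finset ι) {N : Finset E} {b : ℝ} (hb : 0 ≤ b)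
    (hnet : ∀ u : E, ‖u‖ ≤ 1 → ∃ v ∈ N, ‖u - v‖ ≤ 1 / 2)
    (hN : ∀ v ∈ N, ∑ i ∈ S, inner ℝ (x i) v ^ 2 ≤ b * ‖v‖ ^ 2) :
    ‖designMap x S‖ ≤ 3 * √b := by
  refine (designMap x S).opNorm_le_of_half_net (Real.sqrt_nonneg _) hnet fun v hv => ?_
  refine le_of_sq_le_sq ?_ (by positivity)
  rw [norm_designMap_sq, mul_pow, Real.sq_sqrt hb]
  exact hN v hv

lemma sum_inner_sq_le_of_norm_designMap_le {x : ι → E} {S : Finset ι} {K : ℝ}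
    (h : ‖designMap x S‖ ≤ K) (u : E) : ∑ i ∈ S, inner ℝ (x i) u ^ 2 ≤ K ^ 2 * ‖u‖ ^ 2 := by
  rw [← norm_designMap_sq, ← mul_pow]
  exact pow_le_pow_left₀ (norm_nonneg _) (((designMap x S).le_opNorm u).trans (by gcongr)) 2

lemma norm_le_of_net {g : E} {N : Finset E} {b : ℝ} (hb : 0 ≤ b)
    (hnet : ∀ u : E, ‖u‖ ≤ 1 → ∃ v ∈ N, ‖u - v‖ ≤ 1 / 2)
    (hN : ∀ v ∈ N, inner ℝ g v ≤ b * ‖v‖) : ‖g‖ ≤ 3 * b := by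
  rcases eq_or_ne g 0 with rfl | hg
  · rw [norm_zero]; positivity
  have hu : ‖(‖g‖⁻¹ • g)‖ = 1 := by
    rw [norm_smul, norm_inv, norm_norm, inv_mul_cancel₀ (norm_ne_zero_iff.2 hg)]
  obtain ⟨v, hv, huv⟩ := hnet _ hu.le
  have h1 : ‖v‖ ≤ 3 / 2 := by
    have := norm_sub_norm_le v (‖g‖⁻¹ • g)
    rw [norm_sub_rev, hu] at this
    linarith
  have h2 : inner ℝ g (‖g‖⁻¹ • g) = ‖g‖ := by
    rw [inner_smul_right, real_inner_self_eq_norm_sq, sq, ← mul_assoc,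
      inv_mul_cancel₀ (norm_ne_zero_iff.2 hg), one_mul]
  have h3 : inner ℝ g (‖g‖⁻¹ • g - v) ≤ ‖g‖ * (1 / 2) :=
    (real_inner_le_norm _ _).trans (by gcongr)
  rw [inner_sub_right, h2] at h3
  have h4 := (hN v hv).trans (mul_le_mul_of_nonneg_left h1 hb)
  linarith

end Design

/-! ### Exponential moments of squares of sub-Gaussian variables -/

section SubGaussian

variable {Ω : Type*} [MeasurableSpace Ω] {μ : Measure Ω} {Z : Ω → ℝ}

/-- The Gaussian integral of `e^{g² / 4}`. -/
lemma lintegral_exp_sq_div_four_gaussianReal :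
    ∫⁻ g, ENNReal.ofReal (Real.exp (g ^ 2 / 4)) ∂(gaussianReal 0 1) ≤ ENNReal.ofReal (3 / 2) := by
  rw [gaussianReal_of_var_ne_zero 0 one_ne_zero,
    lintegral_withDensity_eq_lintegral_mul _ (measurable_gaussianPDF _ _) (by fun_prop)]
  have h : ∀ g : ℝ, (gaussianPDF 0 1 * fun g => ENNReal.ofReal (Real.exp (g ^ 2 / 4))) g =
      ENNReal.ofReal √2 * gaussianPDF 0 2 g := by
    intro g
    rw [Pi.mul_apply, gaussianPDF, gaussianPDF, ← ENNReal.ofReal_mul (gaussianPDFReal_nonneg _ _ _),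
      ← ENNReal.ofReal_mul (Real.sqrt_nonneg _)]
    congr 1
    simp only [gaussianPDFReal, NNReal.coe_one, NNReal.coe_ofNat, sub_zero, mul_one]
    rw [mul_assoc, ← Real.exp_add, ← mul_assoc]
    congr 1
    · rw [mul_comm (2 * Real.pi) 2, Real.sqrt_mul (by norm_num) (2 * Real.pi)]
      have : √(2 : ℝ) ≠ 0 := by positivity
      field_simp
    · congr 1; ring
  simp_rw [h]
  rw [lintegral_const_mul _ (measurable_gaussianPDF _ _),
    lintegral_gaussianPDF_eq_one 0 two_ne_zero, mul_one]
  refine ENNReal.ofReal_le_ofReal ?_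
  rw [Real.sqrt_le_left (by norm_num)]
  norm_num

lemma ProbabilityTheory.HasSubgaussianMGF.lintegral_exp_le [IsProbabilityMeasure μ] {c : NNReal}
    (h : HasSubgaussianMGF Z c μ) (t : ℝ) :
    ∫⁻ ω, ENNReal.ofReal (Real.exp (t * Z ω)) ∂μ ≤ ENNReal.ofReal (Real.exp (c * t ^ 2 / 2)) := by
  rw [← ofReal_integral_eq_lintegral_ofReal (h.integrable_exp_mul t)
    (Eventually.of_forall fun _ => (Real.exp_pos _).le)]
  exact ENNReal.ofReal_le_ofReal (h.mgf_le t)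

/-- Linearize the square: `e^{z²/4}` is the expectation of `e^{zg/√2}` over a standard Gaussian `g`.
After exchanging the integrals, the sub-Gaussian bound leaves `E e^{g²/4} = √2`. -/
lemma lintegral_exp_sq_div_four_le [IsProbabilityMeasure μ] (hm : Measurable Z)
    (h : HasSubgaussianMGF Z 1 μ) :
    ∫⁻ ω, ENNReal.ofReal (Real.exp (Z ω ^ 2 / 4)) ∂μ ≤ ENNReal.ofReal (3 / 2) := by
  have h1 : ∀ z : ℝ, ENNReal.ofReal (Real.exp (z ^ 2 / 4)) =
      ∫⁻ g, ENNReal.ofReal (Real.exp (z / √2 * g)) ∂(gaussianReal 0 1) := by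
    intro z
    rw [← ofReal_integral_eq_lintegral_ofReal (integrable_exp_mul_gaussianReal _)
      (Eventually.of_forall fun _ => (Real.exp_pos _).le)]
    have := congrFun (mgf_id_gaussianReal (μ := 0) (v := 1)) (z / √2)
    simp only [mgf, id] at this
    rw [this, div_pow, Real.sq_sqrt (by norm_num)]
    congr 2
    simp only [NNReal.coe_one]
    ring
  simp_rw [h1]
  rw [lintegral_lintegral_swap (by fun_prop)]
  refine le_trans (lintegral_mono fun g => ?_) lintegral_exp_sq_div_four_gaussianReal
  have h2 := h.lintegral_exp_le (g / √2)
  rw [div_pow, Real.sq_sqrt (by norm_num), NNReal.coe_one] at h2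
  refine le_trans (le_of_eq ?_) (h2.trans (le_of_eq ?_))
  · refine lintegral_congr fun ω => ?_
    congr 2; ring
  · congr 2; ring

/-- The excess of `Z²` over `T` has an exponential moment within `O(e^{-T/4})` of `1`. Controlling
this excess bounds the sums over all index sets simultaneously. -/
lemma lintegral_exp_max_sq_sub_le [IsProbabilityMeasure μ] (hm : Measurable Z)
    (h : HasSubgaussianMGF Z 1 μ) (T : ℝ) :
    ∫⁻ ω, ENNReal.ofReal (Real.exp (max (Z ω ^ 2 - T) 0 / 4)) ∂μ ≤
      ENNReal.ofReal (Real.exp (3 / 2 * Real.exp (-T / 4))) := by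
  have h1 : ∀ ω, ENNReal.ofReal (Real.exp (max (Z ω ^ 2 - T) 0 / 4)) ≤
      1 + ENNReal.ofReal (Real.exp (-T / 4)) * ENNReal.ofReal (Real.exp (Z ω ^ 2 / 4)) := by
    intro ω
    rw [← ENNReal.ofReal_mul (Real.exp_pos _).le, ← Real.exp_add]
    rcases max_choice (Z ω ^ 2 - T) 0 with h | h <;> rw [h]
    · refine le_add_left (ENNReal.ofReal_le_ofReal (Real.exp_le_exp.2 (by linarith)))
    · simp
  refine (lintegral_mono h1).trans ?_
  rw [lintegral_add_left measurable_const, lintegral_const_mul _ (by fun_prop), lintegral_const,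
    measure_univ, mul_one]
  refine (add_le_add_right (mul_le_mul_right (lintegral_exp_sq_div_four_le hm h) _) _).trans ?_
  rw [← ENNReal.ofReal_mul (Real.exp_pos _).le, ← ENNReal.ofReal_one,
    ← ENNReal.ofReal_add zero_le_one (by positivity)]
  refine ENNReal.ofReal_le_ofReal ?_
  have := Real.add_one_le_exp (3 / 2 * Real.exp (-T / 4))
  linarith

lemma lintegral_exp_neg_sq_le [IsProbabilityMeasure μ] (hm : Measurable Z)
    (h : HasSubgaussianMGF Z 1 μ) (h2 : ∫ ω, Z ω ^ 2 ∂μ = 1) :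
    ∫⁻ ω, ENNReal.ofReal (Real.exp (-(1 / 100) * Z ω ^ 2)) ∂μ ≤
      ENNReal.ofReal (Real.exp (-(76 / 10000))) := by
  have hexp : Integrable (fun ω => Real.exp (Z ω ^ 2 / 4)) μ := by
    refine ⟨by fun_prop, ?_⟩
    rw [hasFiniteIntegral_iff_ofReal (Eventually.of_forall fun _ => (Real.exp_pos _).le)]
    exact (lintegral_exp_sq_div_four_le hm h).trans_lt ENNReal.ofReal_lt_top
  have hsq : Integrable (fun ω => Z ω ^ 2) μ := (h.memLp 2).integrable_sq
  have hle : ∫ ω, Real.exp (Z ω ^ 2 / 4) ∂μ ≤ 3 / 2 := by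
    rw [integral_eq_lintegral_of_nonneg_ae (Eventually.of_forall fun _ => (Real.exp_pos _).le)
      (by fun_prop)]
    exact ENNReal.toReal_le_of_le_ofReal (by norm_num) (lintegral_exp_sq_div_four_le hm h)
  -- The quadratic term `z²/20000` of `e^{-z/100}` is `16/10000` times the term `z²/32` of
  -- `e^{z/4}`. In expectation the bound is at most `1 - 100/10000 + 24/10000`.
  have hpt : ∀ ω, Real.exp (-(1 / 100) * Z ω ^ 2) ≤
      1 - 1 / 100 * Z ω ^ 2 + 16 / 10000 * Real.exp (Z ω ^ 2 / 4) := by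
    intro ω
    have hz := sq_nonneg (Z ω)
    set z := Z ω ^ 2
    have h1 := Real.quadratic_le_exp_of_nonneg (x := z / 4) (by positivity)
    have h3 := Real.quadratic_le_exp_of_nonneg (x := 1 / 100 * z) (by positivity)
    rw [neg_mul, Real.exp_neg, inv_le_comm₀ (Real.exp_pos _) (by nlinarith)]
    refine le_trans ?_ h3
    rw [inv_le_iff_one_le_mul₀ (by nlinarith)]
    nlinarith [mul_nonneg hz (sq_nonneg z), mul_nonneg hz hz]
  have hint : Integrable (fun ω => 1 - 1 / 100 * Z ω ^ 2 + 16 / 10000 * Real.exp (Z ω ^ 2 / 4)) μ :=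
    ((integrable_const 1).sub (hsq.const_mul _)).add (hexp.const_mul _)
  have hint0 : Integrable (fun ω => Real.exp (-(1 / 100) * Z ω ^ 2)) μ := by
    refine Integrable.mono' (integrable_const 1) (by fun_prop) (Eventually.of_forall fun ω => ?_)
    rw [Real.norm_eq_abs, abs_of_pos (Real.exp_pos _), Real.exp_le_one_iff]
    nlinarith [sq_nonneg (Z ω)]
  rw [← ofReal_integral_eq_lintegral_ofReal hint0
    (Eventually.of_forall fun _ => (Real.exp_pos _).le)]
  refine ENNReal.ofReal_le_ofReal ((integral_mono hint0 hint hpt).trans ?_)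
  have e1 : ∫ ω, (1 - 1 / 100 * Z ω ^ 2 + 16 / 10000 * Real.exp (Z ω ^ 2 / 4)) ∂μ =
      1 - 1 / 100 * 1 + 16 / 10000 * ∫ ω, Real.exp (Z ω ^ 2 / 4) ∂μ := by
    have hint1 : Integrable (fun ω => 1 - 1 / 100 * Z ω ^ 2) μ :=
      (integrable_const 1).sub (hsq.const_mul _)
    rw [integral_add hint1 (hexp.const_mul _),
      integral_sub (integrable_const 1) (hsq.const_mul _), integral_const_mul, integral_const_mul,
      h2]
    simp
  rw [e1]
  have := Real.add_one_le_exp (-(76 / 10000) : ℝ)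
  linarith

end SubGaussian

/-! ### Concentration of the design in a fixed direction -/

namespace IsSubGaussianDesign

variable {Ω : Type*} [MeasurableSpace Ω] {μ : Measure Ω} {n p : ℕ}
  {X : Fin n → Ω → EuclideanSpace ℝ (Fin p)}

lemma measurable_inner (h : IsSubGaussianDesign μ X) (i : Fin n) (u : EuclideanSpace ℝ (Fin p)) :
    Measurable fun ω => (inner ℝ (X i ω) u : ℝ) := by
  have := h.measurable i
  fun_prop

lemma hasSubgaussianMGF_inner (h : IsSubGaussianDesign μ X) (i : Fin n)
    (u : EuclideanSpace ℝ (Fin p)) :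
    HasSubgaussianMGF (fun ω => (inner ℝ (X i ω) u : ℝ)) (‖u‖₊ ^ 2) μ := by
  have e : ∀ t : ℝ, (fun ω => Real.exp (t * inner ℝ (X i ω) u)) =
      fun ω => Real.exp (inner ℝ (t • u) (X i ω)) := by
    intro t
    funext ω
    rw [inner_smul_left, real_inner_comm, conj_trivial]
  refine ⟨fun t => ?_, fun t => ?_⟩
  · rw [e]
    exact h.integrable_exp i _
  · rw [mgf, e]
    refine (h.subGaussian i _).trans (le_of_eq ?_)
    congr 1
    rw [norm_smul, mul_pow, Real.norm_eq_abs, sq_abs]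
    push_cast
    ring

lemma integral_inner_sq (h : IsSubGaussianDesign μ X) [IsProbabilityMeasure μ] (i : Fin n)
    (u : EuclideanSpace ℝ (Fin p)) :
    ∫ ω, (inner ℝ (X i ω) u : ℝ) ^ 2 ∂μ = ‖u‖ ^ 2 := by
  have hint : ∀ j k, Integrable (fun ω => X i ω j * X i ω k) μ := by
    intro j k
    have hmem : ∀ j, MemLp (fun ω => X i ω j) 2 μ := by
      intro j
      have := (h.hasSubgaussianMGF_inner i (EuclideanSpace.single j 1)).memLp 2
      simpa [EuclideanSpace.inner_single_right] using this
    exact (hmem j).integrable_mul (hmem k)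
  have e : ∀ ω, (inner ℝ (X i ω) u : ℝ) ^ 2 =
      ∑ j, ∑ k, u j * u k * (X i ω j * X i ω k) := by
    intro ω
    rw [PiLp.inner_apply, sq, Finset.sum_mul_sum]
    refine Finset.sum_congr rfl fun j _ => Finset.sum_congr rfl fun k _ => ?_
    simp only [RCLike.inner_apply, conj_trivial]
    ring
  simp_rw [e]
  rw [integral_finsetSum _ fun j _ => integrable_finsetSum _ fun k _ => (hint j k).const_mul _]
  rw [EuclideanSpace.norm_sq_eq]
  refine Finset.sum_congr rfl fun j _ => ?_
  rw [integral_finsetSum _ fun k _ => (hint j k).const_mul _]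
  simp_rw [integral_const_mul, h.isotropic, Matrix.one_apply]
  simp [sq]

end IsSubGaussianDesign

lemma measure_exists_mem_finset_le {Ω E : Type*} [MeasurableSpace Ω] {μ : Measure Ω} (N : Finset E)
    {P : Ω → E → Prop} {b : ℝ≥0∞} (h : ∀ v ∈ N, μ {ω | P ω v} ≤ b) :
    μ {ω | ∃ v ∈ N, P ω v} ≤ N.card * b := by
  have e : {ω | ∃ v ∈ N, P ω v} = ⋃ v ∈ N, {ω | P ω v} := by ext; simp
  rw [e]
  refine (measure_biUnion_finset_le N _).trans ((Finset.sum_le_sum h).trans ?_)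
  rw [Finset.sum_const, nsmul_eq_mul]

namespace IsSubGaussianDesign

variable {Ω : Type*} [MeasurableSpace Ω] {μ : Measure Ω} {n p : ℕ}
  {X : Fin n → Ω → EuclideanSpace ℝ (Fin p)}

lemma hasSubgaussianMGF_inner_of_norm_eq_one (h : IsSubGaussianDesign μ X) (i : Fin n)
    {u : EuclideanSpace ℝ (Fin p)} (hu : ‖u‖ = 1) :
    HasSubgaussianMGF (fun ω => (inner ℝ (X i ω) u : ℝ)) 1 μ := by
  have := h.hasSubgaussianMGF_inner i u
  rwa [show ‖u‖₊ ^ 2 = 1 by ext; simp [hu]] at this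

lemma iIndepFun_comp_inner (h : IsSubGaussianDesign μ X) {g : Fin n → ℝ → ℝ}
    (hg : ∀ i, Measurable (g i)) (u : EuclideanSpace ℝ (Fin p)) :
    iIndepFun (fun i ω => g i (inner ℝ (X i ω) u)) μ :=
  h.indep.comp (fun i x => g i (inner ℝ x u)) (fun i => (hg i).comp (by fun_prop))

variable [IsProbabilityMeasure μ]

lemma measure_exists_sum_inner_sq_gt_of_norm_eq_one (h : IsSubGaussianDesign μ X) (T t : ℝ)
    {u : EuclideanSpace ℝ (Fin p)} (hu : ‖u‖ = 1) :
    μ {ω | ∃ S : Finset (Fin n), S.card * T + 6 * n * Real.exp (-T / 4) + 4 * t <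
      ∑ i ∈ S, (inner ℝ (X i ω) u : ℝ) ^ 2} ≤ ENNReal.ofReal (Real.exp (-t)) := by
  have hm := fun i => h.measurable_inner i u
  have hch := measure_sum_ge_le_exp_neg (μ := μ)
    (Z := fun i ω => max ((inner ℝ (X i ω) u : ℝ) ^ 2 - T) 0 / 4)
    (c := fun _ => 3 / 2 * Real.exp (-T / 4)) (fun i => by have := hm i; fun_prop)
    (h.iIndepFun_comp_inner (g := fun _ z => max (z ^ 2 - T) 0 / 4) (fun _ => by fun_prop) u)
    (fun i => lintegral_exp_max_sq_sub_le (hm i) (h.hasSubgaussianMGF_inner_of_norm_eq_one i hu) T)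
    t
  refine (measure_mono ?_).trans hch
  rintro ω ⟨S, hS⟩
  -- The set `S` enters only through its cardinality, so one Chernoff bound serves all `S`.
  have h1 : ∑ i ∈ S, (inner ℝ (X i ω) u : ℝ) ^ 2 ≤
      S.card * T + ∑ i, max ((inner ℝ (X i ω) u : ℝ) ^ 2 - T) 0 := by
    calc ∑ i ∈ S, (inner ℝ (X i ω) u : ℝ) ^ 2
        ≤ ∑ i ∈ S, (T + max ((inner ℝ (X i ω) u : ℝ) ^ 2 - T) 0) :=
          Finset.sum_le_sum fun i _ => by
            have := le_max_left ((inner ℝ (X i ω) u : ℝ) ^ 2 - T) 0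
            linarith
      _ = S.card * T + ∑ i ∈ S, max ((inner ℝ (X i ω) u : ℝ) ^ 2 - T) 0 := by
          rw [Finset.sum_add_distrib, Finset.sum_const, nsmul_eq_mul]
      _ ≤ _ := add_le_add_right (Finset.sum_le_sum_of_subset_of_nonneg (Finset.subset_univ _)
          fun i _ _ => le_max_right _ _) _
  simp only [Set.mem_ofPred_eq, ← Finset.sum_div, Finset.sum_const, Finset.card_univ,
    Fintype.card_fin, nsmul_eq_mul]
  linarith

lemma measure_sum_inner_sq_lt_of_norm_eq_one (h : IsSubGaussianDesign μ X) (t : ℝ)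
    {u : EuclideanSpace ℝ (Fin p)} (hu : ‖u‖ = 1) :
    μ {ω | ∑ i, (inner ℝ (X i ω) u : ℝ) ^ 2 < 76 / 100 * n - 100 * t} ≤
      ENNReal.ofReal (Real.exp (-t)) := by
  have hm := fun i => h.measurable_inner i u
  have hch := measure_sum_ge_le_exp_neg (μ := μ)
    (Z := fun i ω => -(1 / 100) * (inner ℝ (X i ω) u : ℝ) ^ 2)
    (c := fun _ => -(76 / 10000)) (fun i => by have := hm i; fun_prop)
    (h.iIndepFun_comp_inner (g := fun _ z => -(1 / 100) * z ^ 2) (fun _ => by fun_prop) u)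
    (fun i => lintegral_exp_neg_sq_le (hm i) (h.hasSubgaussianMGF_inner_of_norm_eq_one i hu)
      (by rw [h.integral_inner_sq, hu, one_pow])) t
  refine (measure_mono fun ω hω => ?_).trans hch
  simp only [Set.mem_ofPred_eq, ← Finset.mul_sum, Finset.sum_const, Finset.card_univ,
    Fintype.card_fin, nsmul_eq_mul] at hω ⊢
  linarith

lemma measure_exists_sum_inner_sq_gt (h : IsSubGaussianDesign μ X) (T t : ℝ)
    (v : EuclideanSpace ℝ (Fin p)) :
    μ {ω | ∃ S : Finset (Fin n), (S.card * T + 6 * n * Real.exp (-T / 4) + 4 * t) * ‖v‖ ^ 2 <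
      ∑ i ∈ S, (inner ℝ (X i ω) v : ℝ) ^ 2} ≤ ENNReal.ofReal (Real.exp (-t)) := by
  rcases eq_or_ne v 0 with rfl | hv
  · simp
  have hv' : 0 < ‖v‖ := norm_pos_iff.2 hv
  refine (measure_mono ?_).trans (h.measure_exists_sum_inner_sq_gt_of_norm_eq_one T t
    (u := ‖v‖⁻¹ • v) (by rw [norm_smul, norm_inv, norm_norm, inv_mul_cancel₀ hv'.ne']))
  rintro ω ⟨S, hS⟩
  refine ⟨S, ?_⟩
  simp only [inner_smul_right, mul_pow, ← Finset.mul_sum]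
  rw [inv_pow, ← div_eq_inv_mul, lt_div_iff₀ (by positivity)]
  exact hS

lemma measure_sum_inner_sq_lt (h : IsSubGaussianDesign μ X) (t : ℝ)
    (v : EuclideanSpace ℝ (Fin p)) :
    μ {ω | ∑ i, (inner ℝ (X i ω) v : ℝ) ^ 2 < (76 / 100 * n - 100 * t) * ‖v‖ ^ 2} ≤
      ENNReal.ofReal (Real.exp (-t)) := by
  rcases eq_or_ne v 0 with rfl | hv
  · simp
  have hv' : 0 < ‖v‖ := norm_pos_iff.2 hv
  refine (measure_mono ?_).trans (h.measure_sum_inner_sq_lt_of_norm_eq_one t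
    (u := ‖v‖⁻¹ • v) (by rw [norm_smul, norm_inv, norm_norm, inv_mul_cancel₀ hv'.ne']))
  intro ω hω
  simp only [Set.mem_ofPred_eq, inner_smul_right, mul_pow, ← Finset.mul_sum] at hω ⊢
  rw [inv_pow, ← div_eq_inv_mul, div_lt_iff₀ (by positivity)]
  exact hω

/-- Hoeffding's bound for a weighted sum of the design vectors, in a fixed direction. -/
lemma measure_sum_mul_inner_gt (h : IsSubGaussianDesign μ X) {V t : ℝ} (hV : 0 < V) (ht : 0 ≤ t)
    (v : EuclideanSpace ℝ (Fin p)) (w : Fin n → ℝ) (hw : ∑ i, w i ^ 2 ≤ V) :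
    μ {ω | √(2 * V * t) * ‖v‖ < ∑ i, w i * inner ℝ (X i ω) v} ≤
      ENNReal.ofReal (Real.exp (-t)) := by
  rcases eq_or_ne v 0 with rfl | hv
  · simp
  have hv' : 0 < ‖v‖ := norm_pos_iff.2 hv
  have hm := fun i => h.measurable_inner i v
  -- The optimal Chernoff parameter: the log-moment bound `l² ‖v‖² V / 2` then equals `t`.
  set l := √(2 * t / V) / ‖v‖ with hl
  have hl0 : 0 ≤ l := by positivity
  have hl2 : l ^ 2 * ‖v‖ ^ 2 * V = 2 * t := by
    rw [hl, div_pow, Real.sq_sqrt (by positivity)]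
    field_simp
  have hl3 : l * (√(2 * V * t) * ‖v‖) = 2 * t := by
    rw [hl, mul_comm √(2 * V * t), ← mul_assoc, div_mul_cancel₀ _ hv'.ne',
      ← Real.sqrt_mul (by positivity)]
    rw [show 2 * t / V * (2 * V * t) = (2 * t) ^ 2 by field_simp, Real.sqrt_sq (by positivity)]
  have hch := measure_sum_ge_le_exp_neg (μ := μ)
    (Z := fun i ω => l * w i * (inner ℝ (X i ω) v : ℝ))
    (c := fun i => ‖v‖ ^ 2 * (l * w i) ^ 2 / 2) (fun i => by have := hm i; fun_prop)
    (h.iIndepFun_comp_inner (g := fun i z => l * w i * z) (fun _ => by fun_prop) v)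
    (fun i => by simpa using (h.hasSubgaussianMGF_inner i v).lintegral_exp_le (l * w i)) t
  refine (measure_mono fun ω hω => ?_).trans hch
  have h1 : ∑ i, ‖v‖ ^ 2 * (l * w i) ^ 2 / 2 = l ^ 2 * ‖v‖ ^ 2 / 2 * ∑ i, w i ^ 2 := by
    rw [Finset.mul_sum]
    exact Finset.sum_congr rfl fun i _ => by ring
  have h2 : l ^ 2 * ‖v‖ ^ 2 / 2 * ∑ i, w i ^ 2 ≤ t := by
    refine (mul_le_mul_of_nonneg_left hw (by positivity)).trans (le_of_eq ?_)
    linarith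
  have h3 := mul_le_mul_of_nonneg_left (le_of_lt hω) hl0
  rw [hl3] at h3
  simp only [Set.mem_ofPred_eq, mul_assoc, ← Finset.mul_sum] at h3 ⊢
  rw [h1]
  linarith

/-- Hoeffding's bound for a sum of the design vectors with random weights that are independent of
the design. -/
lemma measure_sum_comp_mul_inner_gt (h : IsSubGaussianDesign μ X) {ξ : Fin n → Ω → ℝ}
    (hξ : ∀ i, Measurable (ξ i)) (hind : IndepFun (fun ω i => X i ω) (fun ω i => ξ i ω) μ)
    {g : ℝ → ℝ} (hg : Measurable g) {V t : ℝ} (hV : 0 < V) (ht : 0 ≤ t)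
    (v : EuclideanSpace ℝ (Fin p)) :
    μ {ω | ∑ i, g (ξ i ω) ^ 2 ≤ V ∧
      √(2 * V * t) * ‖v‖ < ∑ i, g (ξ i ω) * inner ℝ (X i ω) v} ≤
      ENNReal.ofReal (Real.exp (-t)) := by
  have hXm : Measurable fun ω i => X i ω := measurable_pi_lambda _ h.measurable
  have hξm : Measurable fun ω i => ξ i ω := measurable_pi_lambda _ hξ
  set B : Set ((Fin n → EuclideanSpace ℝ (Fin p)) × (Fin n → ℝ)) :=
    {z | ∑ i, g (z.2 i) ^ 2 ≤ V ∧ √(2 * V * t) * ‖v‖ < ∑ i, g (z.2 i) * inner ℝ (z.1 i) v} with hB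
  have hBm : MeasurableSet B := by
    have h1 : MeasurableSet {z : (Fin n → EuclideanSpace ℝ (Fin p)) × (Fin n → ℝ) |
        ∑ i, g (z.2 i) ^ 2 ≤ V} := measurableSet_le (by fun_prop) (by fun_prop)
    have h2 : MeasurableSet {z : (Fin n → EuclideanSpace ℝ (Fin p)) × (Fin n → ℝ) |
        √(2 * V * t) * ‖v‖ < ∑ i, g (z.2 i) * inner ℝ (z.1 i) v} :=
      measurableSet_lt (by fun_prop) (by fun_prop)
    exact h1.inter h2
  have hmap := (indepFun_iff_map_prod_eq_prod_map_map hXm.aemeasurable hξm.aemeasurable).1 hind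
  have hpX : IsProbabilityMeasure (μ.map fun ω i => X i ω) :=
    Measure.isProbabilityMeasure_map hXm.aemeasurable
  have hpξ : IsProbabilityMeasure (μ.map fun ω i => ξ i ω) :=
    Measure.isProbabilityMeasure_map hξm.aemeasurable
  have e : μ {ω | ∑ i, g (ξ i ω) ^ 2 ≤ V ∧
      √(2 * V * t) * ‖v‖ < ∑ i, g (ξ i ω) * inner ℝ (X i ω) v} =
      (μ.map fun ω => ((fun i => X i ω), (fun i => ξ i ω))) B := by
    rw [Measure.map_apply (hXm.prodMk hξm) hBm]
    rfl
  -- By independence the joint law is a product, so the weights can be frozen and the bound applied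
  -- for each value of the noise.
  rw [e, hmap, Measure.prod_apply_symm hBm]
  calc ∫⁻ w, (μ.map fun ω i => X i ω) ((fun x => (x, w)) ⁻¹' B) ∂(μ.map fun ω i => ξ i ω)
      ≤ ∫⁻ _w, ENNReal.ofReal (Real.exp (-t)) ∂(μ.map fun ω i => ξ i ω) := by
        refine lintegral_mono fun w => ?_
        rw [Measure.map_apply hXm (hBm.preimage (by fun_prop))]
        by_cases hw : ∑ i, g (w i) ^ 2 ≤ V
        · exact (measure_mono fun ω hω => hω.2).trans
            (h.measure_sum_mul_inner_gt hV ht v (fun i => g (w i)) hw)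
        · refine (le_of_eq ?_).trans zero_le
          convert measure_empty (μ := μ)
          ext ω
          simp [hB, hw]
    _ = _ := by rw [lintegral_const, measure_univ, mul_one]

end IsSubGaussianDesign

/-! ### Truncated second moments of the noise -/

namespace IsNoise

variable {Ω : Type*} [MeasurableSpace Ω] {μ : Measure Ω} {n : ℕ}
  {ℓ : ℝ≥0∞} {a : ℝ} {ξ : Fin n → Ω → ℝ}

lemma integral_sq (h : IsNoise μ ℓ a ξ) (i : Fin n) : ∫ ω, ξ i ω ^ 2 ∂μ = 1 := by
  have := h.unit_variance i
  rw [variance_of_integral_eq_zero (h.measurable i).aemeasurable (h.centered i)] at this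
  exact this

variable [IsProbabilityMeasure μ]

lemma integral_min_le (h : IsNoise μ ℓ a ξ) (τ : ℝ) (i : Fin n) :
    Integrable (fun ω => min (τ * ξ i ω ^ 2) 1) μ ∧ ∫ ω, min (τ * ξ i ω ^ 2) 1 ∂μ ≤ τ := by
  have hm := h.measurable i
  have hsq : Integrable (fun ω => τ * ξ i ω ^ 2) μ := (h.memLp i).integrable_sq.const_mul _
  have hint : Integrable (fun ω => min (τ * ξ i ω ^ 2) 1) μ := hsq.inf (integrable_const 1)
  refine ⟨hint, (integral_mono hint hsq fun ω => min_le_left _ _).trans ?_⟩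
  rw [integral_const_mul, h.integral_sq, mul_one]

lemma lintegral_exp_min_le (h : IsNoise μ ℓ a ξ) {τ : ℝ} (hτ : 0 ≤ τ) (i : Fin n) :
    ∫⁻ ω, ENNReal.ofReal (Real.exp (min (τ * ξ i ω ^ 2) 1)) ∂μ ≤
      ENNReal.ofReal (Real.exp (2 * τ)) := by
  have hm := h.measurable i
  obtain ⟨hint, hle⟩ := h.integral_min_le τ i
  have hpt : ∀ ω, Real.exp (min (τ * ξ i ω ^ 2) 1) ≤ 1 + 2 * min (τ * ξ i ω ^ 2) 1 := by
    intro ω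
    have h0 : 0 ≤ min (τ * ξ i ω ^ 2) 1 := le_min (by positivity) zero_le_one
    have h1 : min (τ * ξ i ω ^ 2) 1 ≤ 1 := min_le_right _ _
    have h2 := Real.abs_exp_sub_one_sub_id_le (abs_le.2 ⟨by linarith, h1⟩)
    have h3 := (abs_le.1 h2).2
    nlinarith
  have hint2 : Integrable (fun ω => 1 + 2 * min (τ * ξ i ω ^ 2) 1) μ :=
    (integrable_const 1).add (hint.const_mul 2)
  refine (lintegral_mono fun ω => ENNReal.ofReal_le_ofReal (hpt ω)).trans ?_
  rw [← ofReal_integral_eq_lintegral_ofReal hint2 (Eventually.of_forall fun ω => by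
    have : 0 ≤ min (τ * ξ i ω ^ 2) 1 := le_min (by positivity) zero_le_one
    change 0 ≤ 1 + 2 * min (τ * ξ i ω ^ 2) 1
    linarith)]
  refine ENNReal.ofReal_le_ofReal ?_
  rw [integral_add (integrable_const 1) (hint.const_mul 2), integral_const_mul]
  have := Real.add_one_le_exp (2 * τ)
  simp only [integral_const, probReal_univ, smul_eq_mul, mul_one]
  linarith

/-- The truncated second moment of the noise is bounded with high probability. -/
lemma measure_sum_min_gt_le (h : IsNoise μ ℓ a ξ) {τ δ : ℝ} (hn : 0 < n) (hτ : 0 < τ) (hδ : 0 < δ)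
    (hδ' : δ < 1) :
    μ {ω | 16 * τ * n + 4 * Real.log (1 / δ) < ∑ i, min (τ * ξ i ω ^ 2) 1} ≤
      ENNReal.ofReal (δ / 8) := by
  have hn' : (0 : ℝ) < n := by exact_mod_cast hn
  have hm := h.measurable
  have hL : 0 < Real.log (1 / δ) := Real.log_pos (by rw [lt_div_iff₀ hδ]; linarith)
  -- For `δ` near `1`, `log (1 / δ)` is too small to absorb the `log 8` of the union bound. Markov's
  -- inequality suffices there, since `1/16 ≤ δ/8`.
  rcases le_or_gt (1 / 2) δ with hcase | hcase
  · have hnn : ∀ ω, 0 ≤ ∑ i, min (τ * ξ i ω ^ 2) 1 := fun ω =>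
      Finset.sum_nonneg fun i _ => le_min (by positivity) zero_le_one
    have hint : Integrable (fun ω => ∑ i, min (τ * ξ i ω ^ 2) 1) μ :=
      integrable_finsetSum _ fun i _ => (h.integral_min_le τ i).1
    have hle : ∫ ω, ∑ i, min (τ * ξ i ω ^ 2) 1 ∂μ ≤ n * τ := by
      rw [integral_finsetSum _ fun i _ => (h.integral_min_le τ i).1]
      refine (Finset.sum_le_sum fun i _ => (h.integral_min_le τ i).2).trans (le_of_eq ?_)
      simp
    have hmk := mul_meas_ge_le_integral_of_nonneg (Eventually.of_forall hnn) hint (16 * τ * n)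
    rw [measureReal_def] at hmk
    have h1 : (μ {ω | 16 * τ * n ≤ ∑ i, min (τ * ξ i ω ^ 2) 1}).toReal ≤ δ / 8 := by
      have h2 := hmk.trans hle
      have h3 : 16 * (μ {ω | 16 * τ * n ≤ ∑ i, min (τ * ξ i ω ^ 2) 1}).toReal ≤ 1 := by
        refine le_of_mul_le_mul_right ?_ (mul_pos hn' hτ)
        linarith
      linarith
    refine (measure_mono fun ω hω => ?_).trans (ENNReal.le_ofReal_iff_toReal_le
      (measure_ne_top _ _) (by positivity) |>.2 h1)
    simp only [Set.mem_ofPred_eq] at hω ⊢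
    linarith
  · have hch := measure_sum_ge_le_exp_neg (μ := μ) (Z := fun i ω => min (τ * ξ i ω ^ 2) 1)
      (c := fun _ => 2 * τ) (fun i => by have := hm i; fun_prop)
      (h.indep.comp (fun _ z => min (τ * z ^ 2) 1) (fun _ => by fun_prop))
      (fun i => h.lintegral_exp_min_le hτ.le i) (Real.log (1 / δ) + Real.log 8)
    have e : Real.exp (-(Real.log (1 / δ) + Real.log 8)) = δ / 8 := by
      rw [← Real.log_mul (by positivity) (by norm_num), Real.exp_neg, Real.exp_log (by positivity)]
      field_simp
    rw [e] at hch
    have h8 : Real.log 8 ≤ 3 * Real.log (1 / δ) := by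
      have h1 : Real.log 8 = 3 * Real.log 2 := by
        rw [show (8 : ℝ) = 2 ^ 3 by norm_num, Real.log_pow]; norm_num
      have h2 : Real.log 2 ≤ Real.log (1 / δ) :=
        Real.log_le_log (by norm_num) (by rw [le_div_iff₀ hδ]; linarith)
      linarith
    refine (measure_mono fun ω hω => ?_).trans hch
    simp only [Set.mem_ofPred_eq, Finset.sum_const, Finset.card_univ, Fintype.card_fin,
      nsmul_eq_mul] at hω ⊢
    have : 0 < τ * n := by positivity
    linarith

end IsNoise

/-! ### Uniform bounds over directions -/

/-- The error probability of a union bound over a net. -/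
lemma card_net_mul_exp_neg_le {N p k : ℕ} {δ : ℝ} (hδ : 0 < δ) (hp : 0 < p) (hk : k ≤ 7)
    (hN : N ≤ (5 ^ p) ^ k) :
    (N : ℝ≥0∞) * ENNReal.ofReal (Real.exp (-(Real.log (1 / δ) + 20 * p))) ≤
      ENNReal.ofReal (δ / 8) := by
  have h1 : (N : ℝ) ≤ (5 ^ 7) ^ p := by
    have : N ≤ (5 ^ 7) ^ p := by
      rw [← pow_mul, mul_comm, pow_mul]
      exact hN.trans (Nat.pow_le_pow_right (by positivity) hk)
    exact_mod_cast this
  -- Source of the `20 * p`: it pays for the finest net used, of radius `2^{-7}`, and for the factor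
  -- `8`. This needs `p > 0`.
  have h2 : (8 : ℝ) * (5 ^ 7) ^ p ≤ Real.exp (20 * p) := by
    calc (8 : ℝ) * (5 ^ 7) ^ p ≤ 8 ^ p * (5 ^ 7) ^ p := by
          gcongr
          exact le_self_pow₀ (by norm_num) hp.ne'
      _ = (8 * 5 ^ 7) ^ p := by rw [mul_pow]
      _ ≤ (Real.exp 1 ^ 20) ^ p := by
          gcongr
          calc (8 * 5 ^ 7 : ℝ) ≤ 2 ^ 20 := by norm_num
            _ ≤ Real.exp 1 ^ 20 := by
              gcongr
              linarith [Real.add_one_le_exp 1]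
      _ = Real.exp (20 * p) := by
          rw [← Real.exp_nat_mul, ← Real.exp_nat_mul]
          congr 1; push_cast; ring
  rw [← ENNReal.ofReal_natCast, ← ENNReal.ofReal_mul (Nat.cast_nonneg _)]
  refine ENNReal.ofReal_le_ofReal ?_
  rw [neg_add, Real.exp_add, ← Real.log_inv, Real.exp_log (by positivity), one_div, inv_inv,
    Real.exp_neg, mul_left_comm, ← div_eq_mul_inv]
  refine mul_le_mul_of_nonneg_left ?_ hδ.le
  rw [div_le_iff₀ (Real.exp_pos _)]
  linarith

namespace IsSubGaussianDesign

variable {Ω : Type*} [MeasurableSpace Ω] {μ : Measure Ω} [IsProbabilityMeasure μ] {n p : ℕ}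
  {X : Fin n → Ω → EuclideanSpace ℝ (Fin p)} {δ : ℝ}

lemma measure_norm_designMap_gt_le (h : IsSubGaussianDesign μ X) (hp : 0 < p) (hδ : 0 < δ)
    (hδ' : δ < 1) {T : ℝ} (hT : 0 ≤ T) :
    μ {ω | ¬ ∀ S : Finset (Fin n), ‖designMap (fun i => X i ω) S‖ ≤
      3 * √(S.card * T + 6 * n * Real.exp (-T / 4) + 4 * (Real.log (1 / δ) + 20 * p))} ≤
    ENNReal.ofReal (δ / 8) := by
  have hL : 0 < Real.log (1 / δ) := Real.log_pos (by rw [lt_div_iff₀ hδ]; linarith)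
  obtain ⟨N, hN, hnet⟩ := exists_half_net (EuclideanSpace ℝ (Fin p))
  rw [finrank_euclideanSpace_fin] at hN
  refine le_trans (measure_mono ?_) ((measure_exists_mem_finset_le N fun v _ =>
    h.measure_exists_sum_inner_sq_gt T (Real.log (1 / δ) + 20 * p) v).trans
    (card_net_mul_exp_neg_le hδ hp (k := 1) (by norm_num) (by simpa using hN)))
  intro ω hω
  by_contra hcon
  refine hω fun S => norm_designMap_le_of_net _ S (by positivity) hnet fun v hv => ?_
  by_contra! hlt
  exact hcon ⟨v, hv, S, hlt⟩

/-- A lower bound passes from a net to the sphere only if the operator norm is controlled. Hence the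
implication, whose premise is supplied by another event, and the finer net. -/
lemma measure_lower_isometry_fails_le (h : IsSubGaussianDesign μ X) (hp : 0 < p) (hδ : 0 < δ)
    (hn : 10 ^ 4 * (Real.log (1 / δ) + 20 * p) ≤ n) :
    μ {ω | ¬ (‖designMap (fun i => X i ω) Finset.univ‖ ≤ 9 * √n →
      ∀ u, (n : ℝ) / 2 * ‖u‖ ^ 2 ≤ ∑ i, inner ℝ (X i ω) u ^ 2)} ≤ ENNReal.ofReal (δ / 8) := by
  obtain ⟨N, hN, hnet⟩ := exists_net (EuclideanSpace ℝ (Fin p)) 7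
  rw [finrank_euclideanSpace_fin] at hN
  refine le_trans (measure_mono ?_) ((measure_exists_mem_finset_le N fun v _ =>
    h.measure_sum_inner_sq_lt (Real.log (1 / δ) + 20 * p) v).trans
    (card_net_mul_exp_neg_le hδ hp le_rfl hN))
  intro ω hω
  by_contra hcon
  refine hω fun hA u => ?_
  -- `0.866² ≤ 0.76 - 0.01` on the net; off the net `0.866 (1 - 2^{-7}) - 9·2^{-7} ≥ 3/4`, and
  -- `(3/4)² ≥ 1/2`.
  have h1 := (designMap (fun i => X i ω) Finset.univ).norm_apply_ge_of_net
    (b := 866 / 1000 * √n) (by positivity) hA hnet (fun v hv => by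
      refine le_of_sq_le_sq ?_ (norm_nonneg _)
      rw [norm_designMap_sq]
      have h2 : (76 / 100 * n - 100 * (Real.log (1 / δ) + 20 * p)) * ‖v‖ ^ 2 ≤
          ∑ i, inner ℝ (X i ω) v ^ 2 := by
        by_contra! hlt
        exact hcon ⟨v, hv, hlt⟩
      refine le_trans ?_ h2
      rw [mul_pow, mul_pow, Real.sq_sqrt (Nat.cast_nonneg n)]
      refine mul_le_mul_of_nonneg_right ?_ (sq_nonneg _)
      have : (0 : ℝ) ≤ n := Nat.cast_nonneg n
      linarith) u
  have h3 : (3 / 4 * √n) * ‖u‖ ≤ ‖designMap (fun i => X i ω) Finset.univ u‖ := by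
    refine le_trans (mul_le_mul_of_nonneg_right ?_ (norm_nonneg _)) h1
    have := Real.sqrt_nonneg n
    linarith
  have h4 := pow_le_pow_left₀ (by positivity) h3 2
  rw [norm_designMap_sq, mul_pow, mul_pow, Real.sq_sqrt (Nat.cast_nonneg n)] at h4
  refine le_trans ?_ h4
  have : 0 ≤ (n : ℝ) * ‖u‖ ^ 2 := by positivity
  linarith

lemma measure_norm_sum_smul_gt_le (h : IsSubGaussianDesign μ X) {ξ : Fin n → Ω → ℝ}
    (hξ : ∀ i, Measurable (ξ i)) (hind : IndepFun (fun ω i => X i ω) (fun ω i => ξ i ω) μ)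
    {g : ℝ → ℝ} (hg : Measurable g) {V : ℝ} (hV : 0 < V) (hp : 0 < p) (hδ : 0 < δ) (hδ' : δ < 1) :
    μ {ω | ¬ (∑ i, g (ξ i ω) ^ 2 ≤ V →
      ‖∑ i, g (ξ i ω) • X i ω‖ ≤ 3 * √(2 * V * (Real.log (1 / δ) + 20 * p)))} ≤
    ENNReal.ofReal (δ / 8) := by
  have hL : 0 < Real.log (1 / δ) := Real.log_pos (by rw [lt_div_iff₀ hδ]; linarith)
  obtain ⟨N, hN, hnet⟩ := exists_half_net (EuclideanSpace ℝ (Fin p))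
  rw [finrank_euclideanSpace_fin] at hN
  refine le_trans (measure_mono ?_) ((measure_exists_mem_finset_le N fun v _ =>
    h.measure_sum_comp_mul_inner_gt hξ hind hg hV (t := Real.log (1 / δ) + 20 * p)
      (by positivity) v).trans
    (card_net_mul_exp_neg_le hδ hp (k := 1) (by norm_num) (by simpa using hN)))
  intro ω hω
  by_contra hcon
  refine hω fun hVω => norm_le_of_net (Real.sqrt_nonneg _) hnet fun v hv => ?_
  by_contra! hlt
  refine hcon ⟨v, hv, hVω, ?_⟩
  simpa only [sum_inner, inner_smul_left, conj_trivial] using hlt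

end IsSubGaussianDesign

lemma norm_sum_smul_le_norm_designMap {ι E : Type*} [NormedAddCommGroup E] [InnerProductSpace ℝ E]
    (x : ι → E) (S : Finset ι) (c : ι → ℝ) :
    ‖∑ i ∈ S, c i • x i‖ ≤ ‖designMap x S‖ * √(∑ i ∈ S, c i ^ 2) := by
  set g := ∑ i ∈ S, c i • x i with hg
  have h1 : ‖g‖ ^ 2 = ∑ i ∈ S, c i * inner ℝ (x i) g := by
    rw [← real_inner_self_eq_norm_sq]
    nth_rewrite 1 [hg]
    rw [sum_inner]
    simp only [inner_smul_left, conj_trivial]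
  have h2 := Finset.sum_mul_sq_le_sq_mul_sq S c (fun i => inner ℝ (x i) g)
  rw [← h1] at h2
  have h3 := sum_inner_sq_le_of_norm_designMap_le (le_refl ‖designMap x S‖) g
  have h4 : 0 ≤ ∑ i ∈ S, c i ^ 2 := Finset.sum_nonneg fun i _ => sq_nonneg _
  have h5 := mul_le_mul_of_nonneg_left h3 h4
  refine le_of_sq_le_sq ?_ (by positivity)
  rw [mul_pow, Real.sq_sqrt h4]
  rcases (sq_nonneg ‖g‖).eq_or_lt with h0 | h0
  · rw [← h0]; positivity
  · refine le_of_mul_le_mul_right ?_ h0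
    nlinarith

lemma sqrt_add_le_sqrt_add_sqrt {a b : ℝ} (ha : 0 ≤ a) (hb : 0 ≤ b) : √(a + b) ≤ √a + √b := by
  rw [Real.sqrt_le_left (by positivity), add_sq, Real.sq_sqrt ha, Real.sq_sqrt hb]
  have : 0 ≤ 2 * √a * √b := by positivity
  linarith

/-! ### The tuning parameter and the rates -/

section Rates

variable {C q α l τ : ℝ}

lemma div_tuning_le_one_div (hC : 0 < C) (hq1 : q ≤ 1) (hα : 0 ≤ α) (hl : 0 < l)
    (hαl : α + l ≤ 1) (hτ : τ = C * (α + l) ^ q) : l / τ ≤ 1 / C := by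
  have hb : 0 < α + l := by linarith
  have h1 : α + l ≤ (α + l) ^ q := by
    conv_lhs => rw [← Real.rpow_one (α + l)]
    exact Real.rpow_le_rpow_of_exponent_ge hb hαl hq1
  rw [hτ, div_le_div_iff₀ (by positivity) hC]
  nlinarith

lemma div_tuning_le_rpow_div (hC : 0 < C) (hq0 : 0 ≤ q) (hα : 0 < α) (hl : 0 < l)
    (hτ : τ = C * (α + l) ^ q) : α / τ ≤ α ^ (1 - q) / C := by
  have h1 : α ^ q ≤ (α + l) ^ q := Real.rpow_le_rpow hα.le (by linarith) hq0
  rw [hτ, Real.rpow_sub hα, Real.rpow_one, div_div, mul_comm C]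
  gcongr

/-- With `α = o/n`, the factor `α / τ ≤ α^{1-q} / C` turns `α Λ` into `(α^{1-q/2})² Λ`, the square
of the outlier rate for `q = 2/ℓ`. In the remaining terms `α^{1-q} ≤ 1` is enough. -/
lemma sqrt_outlier_rate_le {Λ π B : ℝ} (hC : 0 < C) (hq0 : 0 ≤ q) (hq1 : q ≤ 1) (hα : 0 < α)
    (hα1 : α ≤ 1) (hl : 0 < l) (hπ : 0 ≤ π) (hΛ : 0 ≤ Λ) (hτ : τ = C * (α + l) ^ q)
    (hB : B ≤ 10 * α * Λ + 80 * (l + π)) :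
    √(B * (α / τ)) ≤ 10 / √C * (α ^ (1 - q / 2) * √Λ + √π + √l) := by
  have h1 := div_tuning_le_rpow_div hC hq0 hα hl hτ
  have hα' : α ^ (1 - q) ≤ 1 := Real.rpow_le_one hα.le hα1 (by linarith)
  have h2 : α * α ^ (1 - q) = (α ^ (1 - q / 2)) ^ 2 := by
    rw [← Real.rpow_natCast (α ^ (1 - q / 2)), ← Real.rpow_mul hα.le]
    conv_lhs => rw [← Real.rpow_one_add' hα.le (by linarith)]
    congr 1; push_cast; ring
  have h3 : B * (α / τ) ≤ 100 / C * ((α ^ (1 - q / 2)) ^ 2 * Λ + π + l) := by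
    calc B * (α / τ) ≤ (10 * α * Λ + 80 * (l + π)) * (α ^ (1 - q) / C) := by
          apply mul_le_mul hB h1 _ (by positivity)
          rw [hτ]; positivity
      _ = 1 / C * (10 * (α * α ^ (1 - q)) * Λ + 80 * (l + π) * α ^ (1 - q)) := by ring
      _ ≤ 1 / C * (100 * ((α ^ (1 - q / 2)) ^ 2 * Λ) + 100 * (l + π)) := by
          rw [h2]
          refine mul_le_mul_of_nonneg_left ?_ (by positivity)
          have : 0 ≤ (α ^ (1 - q / 2)) ^ 2 * Λ := by positivity
          have := mul_le_mul_of_nonneg_left hα' (by positivity : 0 ≤ 80 * (l + π))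
          linarith
      _ = _ := by ring
  refine (Real.sqrt_le_sqrt h3).trans ?_
  rw [Real.sqrt_mul (by positivity), Real.sqrt_div (by norm_num),
    show √(100 : ℝ) = 10 by rw [show (100 : ℝ) = 10 ^ 2 by norm_num]; simp]
  refine mul_le_mul_of_nonneg_left ?_ (by positivity)
  refine (sqrt_add_le_sqrt_add_sqrt (by positivity) (by positivity)).trans ?_
  refine add_le_add_left ((sqrt_add_le_sqrt_add_sqrt (by positivity) hπ).trans ?_) _
  rw [Real.sqrt_mul (by positivity), Real.sqrt_sq (by positivity)]

end Rates

/-- The gradient of the Welsch objective at the true parameter, split into the contributions of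
the noise and of the outliers. -/
lemma norm_gradient_welschObjective_le {n p : ℕ} {x : Fin n → EuclideanSpace ℝ (Fin p)}
    {y e ξ : Fin n → ℝ} {βs : EuclideanSpace ℝ (Fin p)} {τ : ℝ} (hτ : 0 < τ)
    (hy : ∀ i, y i - inner ℝ (x i) βs = e i) (S : Finset (Fin n)) (hS : ∀ i ∉ S, e i = ξ i) :
    ‖gradient (welschObjective τ x y) βs‖ ≤
      1 / n * (‖∑ i, welschInfluence τ (ξ i) • x i‖ +
        ‖designMap x S‖ * √(S.card * (4 / τ))) := by
  have hψ : ∀ r, welschInfluence τ r ^ 2 ≤ 1 / τ := fun r =>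
    (sq_welschInfluence_le hτ r).trans
      ((mul_le_mul_of_nonneg_left (min_le_right _ _) (by positivity)).trans (by rw [mul_one]))
  have hsplit : ∑ i, welschInfluence τ (e i) • x i = ∑ i, welschInfluence τ (ξ i) • x i +
      ∑ i ∈ S, (welschInfluence τ (e i) - welschInfluence τ (ξ i)) • x i := by
    rw [← sub_eq_iff_eq_add', ← Finset.sum_sub_distrib]
    simp only [← sub_smul]
    refine (Finset.sum_subset (Finset.subset_univ S) fun i _ hi => ?_).symm
    rw [hS i hi, sub_self, zero_smul]
  rw [gradient_welschObjective hτ.ne', norm_smul, norm_neg, Real.norm_eq_abs,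
    abs_of_nonneg (by positivity)]
  refine mul_le_mul_of_nonneg_left ?_ (by positivity)
  simp only [hy]
  rw [hsplit]
  refine (norm_add_le _ _).trans (add_le_add_right ((norm_sum_smul_le_norm_designMap _ _ _).trans ?_) _)
  refine mul_le_mul_of_nonneg_left (Real.sqrt_le_sqrt ?_) (norm_nonneg _)
  rw [← nsmul_eq_mul, ← Finset.sum_const]
  refine Finset.sum_le_sum fun i _ => ?_
  have h1 := hψ (e i)
  have h2 := hψ (ξ i)
  have h3 := sq_nonneg (welschInfluence τ (e i) + welschInfluence τ (ξ i))
  have h4 : 4 / τ = 2 * (1 / τ) + 2 * (1 / τ) := by ring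
  nlinarith

/-! ### The good event and its consequences -/

section GoodEvent

variable {n p : ℕ}

lemma sum_min_add_outliers_le {e ξ : Fin n → ℝ} {τ : ℝ} (hτ : 0 ≤ τ) (S : Finset (Fin n))
    (hS : ∀ i ∉ S, e i = ξ i) :
    ∑ i, min (τ * e i ^ 2) 1 ≤ ∑ i, min (τ * ξ i ^ 2) 1 + S.card := by
  classical
  calc ∑ i, min (τ * e i ^ 2) 1
      ≤ ∑ i, (min (τ * ξ i ^ 2) 1 + if i ∈ S then 1 else 0) := by
        refine Finset.sum_le_sum fun i _ => ?_
        split_ifs with hi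
        · have h0 : 0 ≤ min (τ * ξ i ^ 2) 1 := le_min (by positivity) zero_le_one
          linarith [min_le_right (τ * e i ^ 2) 1]
        · rw [hS i hi, add_zero]
    _ = _ := by simp [Finset.sum_add_distrib]

lemma isRegularSample_of_norm_designMap_le {x : Fin n → EuclideanSpace ℝ (Fin p)}
    {e : Fin n → ℝ} {t : ℝ} (hn : 0 < n) (ht : 10 ^ 4 * t ≤ n)
    (hup : ‖designMap x Finset.univ‖ ≤ 9 * √n)
    (hsm : ∀ S : Finset (Fin n), ‖designMap x S‖ ≤
      3 * √(S.card * 32 + 6 * n * Real.exp (-32 / 4) + 4 * t))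
    (hlow : ∀ u, (n : ℝ) / 2 * ‖u‖ ^ 2 ≤ ∑ i, inner ℝ (x i) u ^ 2)
    (hnoise : ∑ i, min (1 / 10 ^ 18 * e i ^ 2) 1 ≤ (n : ℝ) / 10 ^ 16) : IsRegularSample x e where
  pos := hn
  lower := hlow
  upper u := by
    refine (sum_inner_sq_le_of_norm_designMap_le hup u).trans (le_of_eq ?_)
    rw [mul_pow, Real.sq_sqrt (Nat.cast_nonneg n)]
    ring
  small S hS u := by
    have hn' : (0 : ℝ) < n := by exact_mod_cast hn
    have hexp : Real.exp (-32 / 4) ≤ 1 / 2800 := by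
      rw [show (-32 / 4 : ℝ) = -8 by norm_num, Real.exp_neg, one_div]
      refine inv_anti₀ (by norm_num) ?_
      calc (2800 : ℝ) ≤ 2.7 ^ 8 := by norm_num
        _ ≤ Real.exp 1 ^ 8 := by
          gcongr
          linarith [Real.exp_one_gt_d9]
        _ = Real.exp 8 := by rw [← Real.exp_nat_mul]; norm_num
    -- The truncation level `32` balances the terms: `32/12000 + 6/2800 + 4/10^4 ≤ 1/108`, and
    -- `9/108 = 1/12`.
    have hB : S.card * 32 + 6 * n * Real.exp (-32 / 4) + 4 * t ≤ (n : ℝ) / 108 := by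
      have := mul_le_mul_of_nonneg_left hexp (by positivity : (0 : ℝ) ≤ 6 * n)
      linarith
    refine (sum_inner_sq_le_of_norm_designMap_le ((hsm S).trans
      (mul_le_mul_of_nonneg_left (Real.sqrt_le_sqrt hB) (by norm_num))) u).trans (le_of_eq ?_)
    rw [mul_pow, Real.sq_sqrt (by positivity)]
    ring
  noise := hnoise

/-- On the event where the noise, the design and their interaction behave well, the gradient of
the Welsch objective at the true parameter is of the order of the statistical error. -/
lemma norm_gradient_welschObjective_le_rate {x : Fin n → EuclideanSpace ℝ (Fin p)}
    {y e ξ : Fin n → ℝ} {βs : EuclideanSpace ℝ (Fin p)} {C τ q L : ℝ} {o : ℕ} (hn : 0 < n)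
    (hC : 0 < C) (hq0 : 0 ≤ q) (hq1 : q ≤ 1) (hL : 0 < L)
    (hnL : 2 * (o + L) ≤ n) (hτ : τ = C * ((o + L) / n) ^ q)
    (hy : ∀ i, y i - inner ℝ (x i) βs = e i) (S : Finset (Fin n)) (hS : ∀ i ∉ S, e i = ξ i)
    (hSo : S.card ≤ o)
    (hdesign : ‖designMap x S‖ ≤ 3 * √(S.card * (4 * Real.log (Real.exp 1 * n / (2 * o))) +
      6 * n * Real.exp (-(4 * Real.log (Real.exp 1 * n / (2 * o))) / 4) + 4 * (L + 20 * p)))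
    (hnoise : ‖∑ i, welschInfluence τ (ξ i) • x i‖ ≤
      3 * √(2 * ((16 + 4 / C) * n) * (L + 20 * p))) :
    ‖gradient (welschObjective τ x y) βs‖ ≤ (60 / √C + 3 * √(40 * (16 + 4 / C))) *
      (((o : ℝ) / n) ^ (1 - q / 2) * √(Real.log (Real.exp 1 * n / (2 * o))) + √((p : ℝ) / n) +
        √(L / n * Real.log (Real.exp 1 * n / (2 * L)))) := by
  have hn' : (0 : ℝ) < n := by exact_mod_cast hn
  have ho' : (0 : ℝ) ≤ o := Nat.cast_nonneg o
  have hτ0 : 0 < τ := by rw [hτ]; positivity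
  set Λ := Real.log (Real.exp 1 * n / (2 * o)) with hΛdef
  set R := ((o : ℝ) / n) ^ (1 - q / 2) * √Λ with hR
  have hR0 : 0 ≤ R := by positivity
  have hlogL : 1 ≤ Real.log (Real.exp 1 * n / (2 * L)) := by
    rw [Real.le_log_iff_exp_le (by positivity), le_div_iff₀ (by positivity)]
    have := Real.exp_pos 1
    nlinarith
  have hLle : √(L / n) ≤ √(L / n * Real.log (Real.exp 1 * n / (2 * L))) :=
    Real.sqrt_le_sqrt (le_mul_of_one_le_right (by positivity) hlogL)
  have hnoise' : 1 / n * ‖∑ i, welschInfluence τ (ξ i) • x i‖ ≤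
      3 * √(40 * (16 + 4 / C)) * (√((p : ℝ) / n) + √(L / n)) := by
    have h1 : 1 / (n : ℝ) * √(2 * ((16 + 4 / C) * n) * (L + 20 * p)) =
        √(2 * (16 + 4 / C) * (L / n + 20 * (p / n))) := by
      rw [one_div, ← Real.sqrt_sq (inv_nonneg.2 hn'.le), ← Real.sqrt_mul (by positivity)]
      congr 1
      field_simp
    have h2 : √(2 * (16 + 4 / C) * (L / n + 20 * (p / n))) ≤
        √(40 * (16 + 4 / C)) * (√((p : ℝ) / n) + √(L / n)) := by
      refine le_trans ?_ (mul_le_mul_of_nonneg_left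
        (sqrt_add_le_sqrt_add_sqrt (by positivity) (by positivity)) (by positivity))
      rw [← Real.sqrt_mul (by positivity)]
      refine Real.sqrt_le_sqrt ?_
      have : 0 ≤ (16 + 4 / C) * (L / n) := by positivity
      linarith
    calc 1 / n * ‖∑ i, welschInfluence τ (ξ i) • x i‖
        ≤ 1 / n * (3 * √(2 * ((16 + 4 / C) * n) * (L + 20 * p))) := by gcongr
      _ = 3 * (1 / (n : ℝ) * √(2 * ((16 + 4 / C) * n) * (L + 20 * p))) := by ring
      _ ≤ _ := by rw [h1]; linarith
  have hout : 1 / n * (‖designMap x S‖ * √(S.card * (4 / τ))) ≤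
      60 / √C * (R + √((p : ℝ) / n) + √(L / n)) := by
    -- For `o = 0` the quotient in `Λ` is a division by zero and `Λ = log 0 = 0`, but then `S` is
    -- empty.
    rcases Nat.eq_zero_or_pos o with ho | ho
    · have : S.card = 0 := by omega
      rw [this]
      simp only [CharP.cast_eq_zero, zero_mul, Real.sqrt_zero, mul_zero]
      positivity
    have hopos : (0 : ℝ) < o := by exact_mod_cast ho
    have hΛ1 : 1 ≤ Λ := by
      rw [hΛdef, Real.le_log_iff_exp_le (by positivity), le_div_iff₀ (by positivity)]
      have := Real.exp_pos 1
      nlinarith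
    -- The level `T = 4Λ` is chosen so that `n e^{-T/4} = 2o/e`: the total excess is no larger than
    -- the main term `o Λ`.
    have hexp : 6 * n * Real.exp (-(4 * Λ) / 4) ≤ 6 * o * Λ := by
      rw [show -(4 * Λ) / 4 = -Λ by ring, Real.exp_neg, hΛdef, Real.exp_log (by positivity),
        ← hΛdef]
      have he : 2 ≤ Real.exp 1 := by linarith [Real.add_one_le_exp 1]
      calc 6 * n * (Real.exp 1 * n / (2 * o))⁻¹ = 6 * o * (2 / Real.exp 1) := by
            field_simp
        _ ≤ 6 * o * 1 := by
            gcongr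
            rw [div_le_one (Real.exp_pos 1)]
            exact he
        _ ≤ _ := by gcongr
    set B := S.card * (4 * Λ) + 6 * n * Real.exp (-(4 * Λ) / 4) + 4 * (L + 20 * p) with hB
    have hB0 : 0 ≤ B := by positivity
    have hSo' : (S.card : ℝ) ≤ o := by exact_mod_cast hSo
    have hBle : B ≤ 10 * o * Λ + 80 * (L + p) := by
      have := mul_le_mul_of_nonneg_right hSo' (by positivity : 0 ≤ 4 * Λ)
      rw [hB]
      linarith
    have hrate := sqrt_outlier_rate_le (C := C) (q := q) (α := o / n) (l := L / n) (τ := τ)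
      (Λ := Λ) (π := p / n) (B := B / n) hC hq0 hq1 (by positivity)
      (by rw [div_le_one hn']; linarith) (by positivity) (by positivity) (by linarith)
      (by rw [hτ, add_div])
      (by
        rw [div_le_iff₀ hn']
        refine hBle.trans (le_of_eq ?_)
        field_simp)
    have h1 : 1 / (n : ℝ) * (√B * √(o * (4 / τ))) = 2 * √(B / n * (o / n / τ)) := by
      rw [one_div, ← Real.sqrt_sq (inv_nonneg.2 hn'.le), ← Real.sqrt_mul hB0,
        ← Real.sqrt_mul (by positivity), ← Real.sqrt_sq (zero_le_two (α := ℝ)),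
        ← Real.sqrt_mul (by positivity)]
      congr 1
      field_simp
      norm_num
    calc 1 / n * (‖designMap x S‖ * √(S.card * (4 / τ)))
        ≤ 1 / n * ((3 * √B) * √(o * (4 / τ))) := by gcongr
      _ = 3 * (1 / (n : ℝ) * (√B * √(o * (4 / τ)))) := by ring
      _ = 6 * √(B / n * (o / n / τ)) := by rw [h1]; ring
      _ ≤ 6 * (10 / √C * (R + √((p : ℝ) / n) + √(L / n))) := by gcongr
      _ = _ := by ring
  refine (norm_gradient_welschObjective_le hτ0 hy S hS).trans ?_
  rw [mul_add]
  refine (add_le_add hnoise' hout).trans ?_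
  have h1 : 0 ≤ 3 * √(40 * (16 + 4 / C)) := by positivity
  have h2 : 0 ≤ 60 / √C := by positivity
  have h3 : 3 * √(40 * (16 + 4 / C)) * (√((p : ℝ) / n) + √(L / n)) ≤
      3 * √(40 * (16 + 4 / C)) * (R + √((p : ℝ) / n) +
        √(L / n * Real.log (Real.exp 1 * n / (2 * L)))) :=
    mul_le_mul_of_nonneg_left (by linarith) h1
  have h4 : 60 / √C * (R + √((p : ℝ) / n) + √(L / n)) ≤
      60 / √C * (R + √((p : ℝ) / n) +
        √(L / n * Real.log (Real.exp 1 * n / (2 * L)))) :=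
    mul_le_mul_of_nonneg_left (by linarith) h2
  linarith

/-- `ψ(ξ)² ≤ min(τ ξ², 1) / τ`, so the main term is `16 n`. The deviation term `4L/τ` is also
`O(n)`, because `τ ≥ C (o + L)/n` when `q ≤ 1`. -/
lemma sum_sq_welschInfluence_le {ξ : Fin n → ℝ} {C τ q L : ℝ} {o : ℕ} (hn : 0 < n) (hC : 0 < C)
    (hq1 : q ≤ 1) (hL : 0 < L) (hnL : 2 * (o + L) ≤ n)
    (hτ : τ = C * ((o + L) / n) ^ q) (hξ : ∑ i, min (τ * ξ i ^ 2) 1 ≤ 16 * τ * n + 4 * L) :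
    ∑ i, welschInfluence τ (ξ i) ^ 2 ≤ (16 + 4 / C) * n := by
  have hn' : (0 : ℝ) < n := by exact_mod_cast hn
  have ho' : (0 : ℝ) ≤ o := Nat.cast_nonneg o
  have hτ0 : 0 < τ := by rw [hτ]; positivity
  have h1 := div_tuning_le_one_div (C := C) (q := q) (α := o / n) (l := L / n) (τ := τ) hC hq1
    (by positivity) (by positivity) (by rw [← add_div, div_le_one hn']; linarith)
    (by rw [hτ, add_div])
  calc ∑ i, welschInfluence τ (ξ i) ^ 2 ≤ ∑ i, 1 / τ * min (τ * ξ i ^ 2) 1 :=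
        Finset.sum_le_sum fun i _ => sq_welschInfluence_le hτ0 _
    _ = 1 / τ * ∑ i, min (τ * ξ i ^ 2) 1 := by rw [Finset.mul_sum]
    _ ≤ 1 / τ * (16 * τ * n + 4 * L) := by gcongr
    _ = 16 * n + 4 * (L / n / τ) * n := by field_simp
    _ ≤ 16 * n + 4 * (1 / C) * n := by gcongr
    _ = _ := by ring

lemma measurable_welschInfluence (τ : ℝ) : Measurable (welschInfluence τ) := by
  unfold welschInfluence
  fun_prop

/-- The event on which the two-stage algorithm works. -/
lemma exists_good_event {Ω : Type*} [MeasurableSpace Ω] {μ : Measure Ω} [IsProbabilityMeasure μ]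
    {X : Fin n → Ω → EuclideanSpace ℝ (Fin p)} {ξ θ : Fin n → Ω → ℝ} {ℓ : ℝ≥0∞} {a δ τ T V : ℝ}
    {o : ℕ} (hX : IsSubGaussianDesign μ X) (hξ : IsNoise μ ℓ a ξ)
    (hind : IndepFun (fun ω i => X i ω) (fun ω i => ξ i ω) μ)
    (hθ : ∀ᵐ ω ∂μ, {i | θ i ω ≠ 0}.ncard ≤ o) (hp : 0 < p) (hn : 0 < n) (hδ : 0 < δ)
    (hδ' : δ < 1) (hnt : 10 ^ 4 * (Real.log (1 / δ) + 20 * p) ≤ n) (hτ : 0 < τ) (hT : 0 ≤ T)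
    (hV : 0 < V) :
    ∃ E : Set Ω, MeasurableSet E ∧ ENNReal.ofReal (1 - δ) ≤ μ E ∧ ∀ ω ∈ E,
      {i | θ i ω ≠ 0}.ncard ≤ o ∧
      ‖designMap (fun i => X i ω) Finset.univ‖ ≤ 9 * √n ∧
      (∀ S : Finset (Fin n), ‖designMap (fun i => X i ω) S‖ ≤
        3 * √(S.card * 32 + 6 * n * Real.exp (-32 / 4) + 4 * (Real.log (1 / δ) + 20 * p))) ∧
      (∀ S : Finset (Fin n), ‖designMap (fun i => X i ω) S‖ ≤
        3 * √(S.card * T + 6 * n * Real.exp (-T / 4) + 4 * (Real.log (1 / δ) + 20 * p))) ∧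
      (∀ u, (n : ℝ) / 2 * ‖u‖ ^ 2 ≤ ∑ i, inner ℝ (X i ω) u ^ 2) ∧
      ∑ i, min (1 / 10 ^ 18 * ξ i ω ^ 2) 1 ≤
        16 * (1 / 10 ^ 18) * n + 4 * Real.log (1 / δ) ∧
      ∑ i, min (τ * ξ i ω ^ 2) 1 ≤ 16 * τ * n + 4 * Real.log (1 / δ) ∧
      (∑ i, welschInfluence τ (ξ i ω) ^ 2 ≤ V → ‖∑ i, welschInfluence τ (ξ i ω) • X i ω‖ ≤
        3 * √(2 * V * (Real.log (1 / δ) + 20 * p))) := by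
  have b0 : μ {ω | ¬ {i | θ i ω ≠ 0}.ncard ≤ o} ≤ ENNReal.ofReal (δ / 8) :=
    (le_of_eq (ae_iff.1 hθ)).trans zero_le
  have b1 := hX.measure_norm_designMap_gt_le hp hδ hδ' (le_refl 0)
  have b2 := hX.measure_norm_designMap_gt_le hp hδ hδ' (T := 32) (by norm_num)
  have b3 := hX.measure_norm_designMap_gt_le hp hδ hδ' hT
  have b4 := hX.measure_lower_isometry_fails_le hp hδ hnt
  have b5 := hξ.measure_sum_min_gt_le hn (τ := 1 / 10 ^ 18) (by norm_num) hδ hδ'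
  have b6 := hξ.measure_sum_min_gt_le hn hτ hδ hδ'
  have b7 := hX.measure_norm_sum_smul_gt_le hξ.measurable hind (measurable_welschInfluence τ) hV hp
    hδ hδ'
  have union : ∀ {A B : Set Ω} {a b : ℝ}, 0 ≤ a → 0 ≤ b → μ A ≤ ENNReal.ofReal a →
      μ B ≤ ENNReal.ofReal b → μ (A ∪ B) ≤ ENNReal.ofReal (a + b) := by
    intro A B a b ha hb hA hB
    rw [ENNReal.ofReal_add ha hb]
    exact (measure_union_le A B).trans (add_le_add hA hB)
  have hδ8 : 0 ≤ δ / 8 := by positivity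
  have hbad := union (by positivity) hδ8 (union (by positivity) hδ8 (union (by positivity) hδ8
    (union (by positivity) hδ8 (union (by positivity) hδ8 (union (by positivity) hδ8
    (union hδ8 hδ8 b0 b1) b2) b3) b4) b5) b6) b7
  set bad := _ ∪ {ω | ¬ (∑ i, welschInfluence τ (ξ i ω) ^ 2 ≤ V →
      ‖∑ i, welschInfluence τ (ξ i ω) • X i ω‖ ≤
        3 * √(2 * V * (Real.log (1 / δ) + 20 * p)))} with hbaddef
  -- The bad set need not be measurable, as `θ` is arbitrary; its measurable hull has the same
  -- measure.
  refine ⟨(toMeasurable μ bad)ᶜ, (measurableSet_toMeasurable _ _).compl, ?_, ?_⟩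
  · rw [prob_compl_eq_one_sub (measurableSet_toMeasurable _ _), measure_toMeasurable,
      ENNReal.ofReal_sub _ hδ.le, ENNReal.ofReal_one]
    refine tsub_le_tsub_left (hbad.trans (ENNReal.ofReal_le_ofReal (by linarith))) _
  · intro ω hω
    have hω' : ω ∉ bad := fun hmem => hω (subset_toMeasurable _ _ hmem)
    simp only [hbaddef, Set.mem_union, Set.mem_ofPred_eq, not_or, not_not, not_lt] at hω'
    obtain ⟨⟨⟨⟨⟨⟨⟨g0, g1⟩, g2⟩, g3⟩, g4⟩, g5⟩, g6⟩, g7⟩ := hω'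
    -- The truncation level `T = 0` makes the bound independent of `|S|`: `6n + 4t ≤ 9n`.
    have hup : ‖designMap (fun i => X i ω) Finset.univ‖ ≤ 9 * √n := by
      refine (g1 Finset.univ).trans ?_
      have h9 : √(9 * (n : ℝ)) = 3 * √n := by
        rw [Real.sqrt_mul (by norm_num), show (9 : ℝ) = 3 ^ 2 by norm_num,
          Real.sqrt_sq (by norm_num)]
      rw [show 9 * √n = 3 * √(9 * (n : ℝ)) by rw [h9]; ring]
      refine mul_le_mul_of_nonneg_left (Real.sqrt_le_sqrt ?_) (by norm_num)
      have : (0 : ℝ) ≤ n := Nat.cast_nonneg n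
      simp only [mul_zero, neg_zero, zero_div, Real.exp_zero, mul_one, zero_add]
      linarith
    exact ⟨g0, hup, g2, g3, g4 hup, g5, g6, g7⟩

/-- Either `C` is already small and `b ^ q ≤ 1`, or `q` is bounded away from `0` and a small `b`
compensates for a large `C`. -/
lemma tuning_le {C c b q qm C₁ : ℝ} (hC : 0 < C) (hc : 0 < c) (hb0 : 0 < b) (hC₁ : 1 ≤ C₁)
    (hb : b * C₁ ≤ 1) (hq0 : 0 ≤ q) (hqm : qm ≤ q)
    (h : C ≤ c ∨ 0 < qm ∧ (C / c) ^ (1 / qm) ≤ C₁) : C * b ^ q ≤ c := by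
  have hb1 : b ≤ 1 := by nlinarith
  rcases h with h | ⟨hqm0, h⟩
  · calc C * b ^ q ≤ C * 1 := by
          gcongr
          exact Real.rpow_le_one hb0.le hb1 hq0
      _ ≤ c := by linarith
  · have h1 : b * (C / c) ^ (1 / qm) ≤ 1 := (mul_le_mul_of_nonneg_left h hb0.le).trans hb
    have h2 := Real.rpow_le_one (by positivity) h1 hqm0.le
    rw [Real.mul_rpow hb0.le (by positivity), ← Real.rpow_mul (by positivity),
      one_div_mul_cancel hqm0.ne', Real.rpow_one] at h2
    have h3 : b ^ q ≤ b ^ qm := Real.rpow_le_rpow_of_exponent_ge hb0 hb1 hqm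
    calc C * b ^ q ≤ C * b ^ qm := by gcongr
      _ = b ^ qm * (C / c) * c := by field_simp
      _ ≤ 1 * c := by gcongr
      _ = c := one_mul c

end GoodEvent

/-! ### The main theorem -/

theorem proposition2 (a : ℝ) (ha : 0 < a) :
    ∃ C₀ > (0 : ℝ), ∃ η₀ > (0 : ℝ),
    -- any small constant `C` is allowed with constants uniform in `ℓ`, and any constant `C` at all
    -- if `ℓ` stays bounded
    ∀ (C : ℝ) (ℓmax : ℝ≥0∞), 0 < C → 2 ≤ ℓmax → (C ≤ C₀ ∨ ℓmax ≠ ∞) →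
    ∃ C₁ > (0 : ℝ),
    ∀ (ℓ : ℝ≥0∞), 2 ≤ ℓ → ℓ ≤ ℓmax →
    ∀ (n p o : ℕ) (δ : ℝ), 0 < δ → δ < 1 →
    C₁ * (o + Real.log (1 / δ) + p) ≤ n →
    ∀ (Ω : Type*) [MeasurableSpace Ω] (μ : Measure Ω) [IsProbabilityMeasure μ]
      (X : Fin n → Ω → EuclideanSpace ℝ (Fin p)) (ξ θ Y : Fin n → Ω → ℝ)
      (βstar : EuclideanSpace ℝ (Fin p)),
    IsSubGaussianDesign μ X →
    IsNoise μ ℓ a ξ →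
    IndepFun (fun ω i => X i ω) (fun ω i => ξ i ω) μ →
    -- the adversary may choose `θ` as any function of the outcome, with at most `o` nonzero entries
    (∀ᵐ ω ∂μ, {i | θ i ω ≠ 0}.ncard ≤ o) →
    (∀ i ω, Y i ω = inner ℝ (X i ω) βstar + θ i ω + ξ i ω) →
    ∀ τ : ℝ, τ = C * ((o + Real.log (1 / δ)) / n) ^ (2 * (ℓ⁻¹).toReal) →
    ∃ E : Set Ω, MeasurableSet E ∧ ENNReal.ofReal (1 - δ) ≤ μ E ∧ ∀ ω ∈ E,
      -- the first stage has a solution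
      (∃ β₀, IsLADEstimate (fun i => X i ω) (fun i => Y i ω) 0 β₀) ∧
      ∃ βhat : EuclideanSpace ℝ (Fin p),
        -- `βhat` is the unique solution of the Welsch problem
        (∀ β, β ≠ βhat → welschObjective τ (fun i => X i ω) (fun i => Y i ω) βhat <
          welschObjective τ (fun i => X i ω) (fun i => Y i ω) β) ∧
        -- from every output of the first stage, the second stage converges to `βhat`
        (∀ ε ∈ Set.Icc (0 : ℝ) 1, ∀ β₀, IsLADEstimate (fun i => X i ω) (fun i => Y i ω) ε β₀ →
          (∀ b, IsDescentRun (welschObjective τ (fun i => X i ω) (fun i => Y i ω)) β₀ b →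
            Tendsto b atTop (𝓝 βhat)) ∧
          (∀ η, 0 < η → η ≤ η₀ →
            Tendsto (gradientDescent (welschObjective τ (fun i => X i ω) (fun i => Y i ω)) η β₀)
              atTop (𝓝 βhat))) ∧
        ‖βhat - βstar‖ ≤ C₁ *
          (((o : ℝ) / n) ^ (1 - (ℓ⁻¹).toReal) * √(Real.log (Real.exp 1 * n / (2 * o)))
            + √((p : ℝ) / n)
            + √(Real.log (1 / δ) / n *
                Real.log (Real.exp 1 * n / (2 * Real.log (1 / δ))))) := by
  -- `10^(-45)` is the largest `τ` allowed by `exists_minimizer`; `1/162` is half the inverse of the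
  -- Lipschitz constant `81` of the gradient.
  refine ⟨1 / 10 ^ 45, by norm_num, 1 / 162, by norm_num, fun C ℓmax hC hℓmax hCℓ => ?_⟩
  set qm := 2 * (ℓmax⁻¹).toReal with hqm
  set D := 8 * (60 / √C + 3 * √(40 * (16 + 4 / C))) with hD
  set c : ℝ := 1 / 10 ^ 45 with hc
  have hc0 : 0 < c := by rw [hc]; norm_num
  have hD0 : 0 ≤ D := by positivity
  have hpow0 : 0 ≤ (C / c) ^ (1 / qm) := by positivity
  -- The three summands serve regularity of the sample, the error bound, and smallness of `τ`. If
  -- `ℓmax = ∞` then `qm = 0` and the last one is `1`, which is harmless.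
  set C₁ := 10 ^ 20 + D + (C / c) ^ (1 / qm) with hC₁
  have hC₁ge : 10 ^ 20 ≤ C₁ := by linarith
  refine ⟨C₁, by linarith, ?_⟩
  intro ℓ hℓ hℓm n p o δ hδ hδ' hn Ω _ μ _ X ξ θ Y βs hX hξ hind hθ hY τ hτ
  set L := Real.log (1 / δ) with hLdef
  have hL : 0 < L := Real.log_pos (by rw [lt_div_iff₀ hδ]; linarith)
  have ho : (0 : ℝ) ≤ o := Nat.cast_nonneg o
  have hp0 : (0 : ℝ) ≤ p := Nat.cast_nonneg p
  have hn20 : 10 ^ 20 * (o + L + p) ≤ n :=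
    (mul_le_mul_of_nonneg_right hC₁ge (by positivity)).trans hn
  have hn' : (0 : ℝ) < n := by
    have : 0 < 10 ^ 20 * ((o : ℝ) + L + p) := by positivity
    linarith
  have hnpos : 0 < n := by exact_mod_cast hn'
  -- For `p = 0` the net bound fails, but the parameter space is a point.
  rcases Nat.eq_zero_or_pos p with rfl | hp
  · have hsub : ∀ β γ : EuclideanSpace ℝ (Fin 0), β = γ := fun β γ => Subsingleton.elim β γ
    have hconv : ∀ b : ℕ → EuclideanSpace ℝ (Fin 0), Tendsto b atTop (𝓝 0) := fun b =>
      tendsto_const_nhds.congr fun k => hsub _ _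
    refine ⟨Set.univ, MeasurableSet.univ, ?_, fun ω _ => ⟨⟨0, fun β' => ?_⟩, 0,
      fun β hβ => absurd (hsub _ _) hβ, fun ε _ β₀ _ => ⟨fun b _ => hconv b, fun η _ _ => hconv _⟩,
      ?_⟩⟩
    · rw [measure_univ, ← ENNReal.ofReal_one]
      exact ENNReal.ofReal_le_ofReal (by linarith)
    · rw [hsub β' 0]
      simp
    · rw [hsub (0 - βs) 0, norm_zero]
      positivity
  have hp1 : (1 : ℝ) ≤ p := by exact_mod_cast hp
  have hℓinv : ℓ⁻¹ ≤ 2⁻¹ := ENNReal.inv_le_inv.2 hℓ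
  have hq0 : 0 ≤ 2 * (ℓ⁻¹).toReal := by positivity
  have hq1 : 2 * (ℓ⁻¹).toReal ≤ 1 := by
    have := ENNReal.toReal_mono (by simp) hℓinv
    simp only [ENNReal.toReal_inv, ENNReal.toReal_ofNat] at this ⊢
    linarith
  have hqmq : qm ≤ 2 * (ℓ⁻¹).toReal := by
    have hne : ℓ⁻¹ ≠ ∞ := ne_top_of_le_ne_top (by simp) hℓinv
    have := ENNReal.toReal_mono hne (ENNReal.inv_le_inv.2 hℓm)
    linarith
  have hb0 : 0 < (o + L) / n := by positivity
  have hτ0 : 0 < τ := by rw [hτ]; positivity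
  have hτle : τ ≤ c := by
    rw [hτ]
    refine tuning_le hC hc0 hb0 (C₁ := C₁) (by linarith) ?_ hq0 hqmq ?_
    · rw [div_mul_eq_mul_div, div_le_one hn']
      have : 0 ≤ C₁ * p := by positivity
      linarith
    · rcases hCℓ with h | h
      · exact Or.inl h
      · refine Or.inr ⟨?_, by linarith⟩
        have h0 : ℓmax ≠ 0 := (lt_of_lt_of_le (by norm_num) hℓmax).ne'
        have := ENNReal.toReal_pos (ENNReal.inv_ne_zero.2 h) (ENNReal.inv_ne_top.2 h0)
        positivity
  have hnoL : 2 * (o + L) ≤ n := by linarith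
  have hΛ0 : 0 ≤ 4 * Real.log (Real.exp 1 * n / (2 * o)) := by
    rcases ho.eq_or_lt with h0 | h0
    · rw [← h0]; simp
    · have : 0 ≤ Real.log (Real.exp 1 * n / (2 * o)) := by
        refine Real.log_nonneg ?_
        rw [le_div_iff₀ (by positivity)]
        have := Real.add_one_le_exp 1
        nlinarith
      positivity
  obtain ⟨E, hE, hμE, hgood⟩ := exists_good_event (T := 4 * Real.log (Real.exp 1 * n / (2 * o)))
    (V := (16 + 4 / C) * n) hX hξ hind hθ hp hnpos hδ hδ' (by rw [← hLdef]; linarith) hτ0 hΛ0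
    (by positivity)
  refine ⟨E, hE, hμE, fun ω hω => ?_⟩
  obtain ⟨hsparse, hup, hsm, hdes, hlow, hnoise0, hnoise, hgrad⟩ := hgood ω hω
  rw [← hLdef] at hsm hdes hnoise0 hnoise hgrad
  classical
  set S := Finset.univ.filter fun i => θ i ω ≠ 0 with hSdef
  have hScard : S.card ≤ o := by
    rw [← Set.ncard_coe_finset]
    simpa [hSdef] using hsparse
  have hScard' : (S.card : ℝ) ≤ o := by exact_mod_cast hScard
  have he : ∀ i, Y i ω - inner ℝ (X i ω) βs = θ i ω + ξ i ω := fun i => by rw [hY]; ring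
  have hS : ∀ i ∉ S, θ i ω + ξ i ω = ξ i ω := by
    intro i hi
    have : θ i ω = 0 := by simpa [hSdef] using hi
    rw [this, zero_add]
  have hreg : IsRegularSample (fun i => X i ω) fun i => Y i ω - inner ℝ (X i ω) βs := by
    simp only [he]
    refine isRegularSample_of_norm_designMap_le hnpos (t := L + 20 * p) (by linarith) hup hsm hlow ?_
    refine (sum_min_add_outliers_le (by norm_num) S hS).trans ?_
    linarith
  obtain ⟨βhat, huniq, hconv, herr⟩ := hreg.exists_minimizer hτ0 hτle
  refine ⟨hreg.exists_isLADEstimate, βhat, huniq, hconv, herr.trans ?_⟩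
  have hfin := norm_gradient_welschObjective_le_rate (y := fun i => Y i ω) hnpos hC hq0 hq1 hL hnoL
    hτ he S hS hScard (hdes S)
    (hgrad (sum_sq_welschInfluence_le hnpos hC hq1 hL hnoL hτ hnoise))
  rw [mul_div_cancel_left₀ _ (two_ne_zero (α := ℝ))] at hfin
  refine (mul_le_mul_of_nonneg_left hfin (by norm_num)).trans ?_
  rw [← mul_assoc, ← hD]
  exact mul_le_mul_of_nonneg_right (by linarith) (by positivity)
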